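/- Let $\alpha\in(1,2)$ and let $X$ be a totally asymmetric $\alpha$-stable random variable, namely a real random variable with characteristic function $$\mathbb{E}\,e^{itX}=\exp\left(\int_{0}^{\infty}\left(e^{itx}-1-itx\right)\frac{dx}{x^{\alpha+1}}\right),\qquad t\in\mathbb{R}.$$ For every $y\in\left[\frac{2}{\sqrt{2-\alpha}},\frac{1}{2-\alpha}\right]$ one has $$\mathbb{P}\left(X\ge 2y-\frac{1}{\alpha-1}\right)\le\frac{2}{e}\,\frac{1}{y^{\alpha}}+e^{\frac14}e^{-\frac12(2-\alpha)y^{2}}$$ and $$\mathbb{P}\left(X\ge \frac14 y-\frac{1}{\alpha-1}\right)\ge\frac{1}{400\sqrt{e}}\left(e^{-1}\frac{1}{y^{\alpha}}+e^{-(2-\alpha)y^{2}}\right).$$ For every $y\ge\frac{1}{2-\alpha}$ one has $$\mathbb{P}\left(X\ge 2y-\frac{1}{\alpha-1}\right)\le\frac{8}{y^{\alpha}}\qquad\text{and}\qquad \mathbb{P}\left(X\ge y-\frac{1}{\alpha-1}\right)\ge 10^{-3}\,\frac{1}{y^{\alpha}}.$$ -/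

import Mathlib

open MeasureTheory ProbabilityTheory

/-- The exponent `∫₀^∞ (e^{itx} - 1 - itx) x^{-α-1} dx`. For `1 < α < 2` the integrand is
absolutely integrable for every real `t`. -/
noncomputable def stableExponent (α t : ℝ) : ℂ :=
  ∫ x in Set.Ioi (0 : ℝ),
    (Complex.exp (Complex.I * (t * x : ℝ)) - 1 - Complex.I * (t * x : ℝ)) / ((x ^ (α + 1) : ℝ) : ℂ)

/-- `X` is a real random variable on `(Ω, P)` with the totally asymmetric `α`-stable law
(`1 < α < 2`, Lévy measure `x^{-α-1} dx` on `(0, ∞)`, centred): its characteristic function is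
`t ↦ exp (∫₀^∞ (e^{itx} - 1 - itx) x^{-α-1} dx)`. -/
structure IsTotallyAsymmetricStable {Ω : Type*} [MeasurableSpace Ω] (P : Measure Ω)
    (α : ℝ) (X : Ω → ℝ) : Prop where
  aemeasurable : AEMeasurable X P
  charFun_eq : ∀ t : ℝ, charFun (P.map X) t = Complex.exp (stableExponent α t)

/-!
Keeping only the jumps larger than `δ` turns the stable law into a centred compound Poisson law, and
these laws converge weakly to it as `δ → 0`, so both tail bounds may be proved for them, uniformly
in `δ`. A cut at a level `R` splits such a law into an independent sum of small jumps, which have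
exponential moments with exponent close to `l² R^(2-α) / (2(2-α))`, and large jumps, which form a
compound Poisson law of total intensity `1 / (α R^α)`.

Upper bounds: cut at `y`. A large jump occurs with probability at most `1 / (α y^α)`, and otherwise
Chernoff's bound applies with a parameter `u / y`. For `y ≥ 1 / (2-α)` the choice `u = α log y`
suffices. For smaller `y`, `w = (2-α) y²` competes with `α log y`: their minimum is used as long as
`w ≤ 2 α log y`, and `α log y` beyond, where the Chernoff term is first Gaussian and, from
`w ≥ 2.6 α log y` on, absorbed by the slack `2/e - 1/α` of the polynomial term.

Lower bounds: cut at `1`. One jump beyond `3y`, with the small jumps above `-2y`, gives the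
polynomial term. The Paley–Zygmund inequality for the exponential of the small jumps with parameter
`(2-α) y` gives the Gaussian one.
-/

open Filter Set Topology

/-! ### Compound Poisson laws -/

section Conv

variable {M 𝕜 : Type*} [AddMonoid M] [MeasurableSpace M] [MeasurableAdd₂ M] [RCLike 𝕜]
  {μ ν : Measure M} {χ : AddChar M 𝕜}

theorem integrable_addChar_conv (hχ : Measurable χ) (hμ : Integrable χ μ)
    (hν : Integrable χ ν) : Integrable χ (μ ∗ ν) := by
  rw [Measure.conv, integrable_map_measure hχ.aestronglyMeasurable (by fun_prop)]
  exact (hμ.mul_prod hν).congr (.of_forall fun x => (χ.map_add_eq_mul _ _).symm)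

theorem integral_addChar_conv [SFinite μ] [SFinite ν] (hχ : Measurable χ) :
    ∫ x, χ x ∂(μ ∗ ν) = (∫ x, χ x ∂μ) * ∫ x, χ x ∂ν := by
  rw [Measure.conv, integral_map (by fun_prop) hχ.aestronglyMeasurable, ← integral_prod_mul]
  simp only [χ.map_add_eq_mul]

end Conv

/-- The `k`-fold convolution power of a measure, with value `δ₀` at `k = 0`. -/
noncomputable def convPow {M : Type*} [AddMonoid M] [MeasurableSpace M] (ν : Measure M) :
    ℕ → Measure M
  | 0 => Measure.dirac 0
  | k + 1 => convPow ν k ∗ ν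

/-- The compound Poisson law with finite intensity `ν`, that is, the law of the sum of the points
of a Poisson process with intensity `ν`. -/
noncomputable def compoundPoisson {M : Type*} [AddMonoid M] [MeasurableSpace M]
    (ν : Measure M) : Measure M :=
  Measure.sum fun k : ℕ => ENNReal.ofReal (Real.exp (-ν.real univ) / k.factorial) • convPow ν k

section CompoundPoisson

variable {M 𝕜 : Type*} [AddMonoid M] [MeasurableSpace M] [MeasurableAdd₂ M] [RCLike 𝕜]
  {ν : Measure M}

theorem integrable_addChar_convPow {χ : AddChar M 𝕜} (hχ : Measurable χ) (hν : Integrable χ ν)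
    (k : ℕ) : Integrable χ (convPow ν k) := by
  induction k with
  | zero => exact integrable_dirac' hχ.stronglyMeasurable enorm_lt_top
  | succ k ih => exact integrable_addChar_conv hχ ih hν

variable [IsFiniteMeasure ν]

instance (k : ℕ) : IsFiniteMeasure (convPow ν k) := by
  induction k with
  | zero => unfold convPow; infer_instance
  | succ k ih => unfold convPow; infer_instance

theorem integral_addChar_convPow {χ : AddChar M 𝕜} (hχ : Measurable χ) (k : ℕ) :
    ∫ x, χ x ∂(convPow ν k) = (∫ x, χ x ∂ν) ^ k := by
  induction k with
  | zero => rw [convPow, integral_dirac' _ _ hχ.stronglyMeasurable, χ.map_zero_eq_one, pow_zero]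
  | succ k ih => rw [convPow, integral_addChar_conv hχ, ih, pow_succ]

theorem integrable_addChar_compoundPoisson {χ : AddChar M 𝕜} (hχ : Measurable χ)
    (hν : Integrable χ ν) : Integrable χ (compoundPoisson ν) := by
  refine integrable_sum_measure
    (fun k => (integrable_addChar_convPow hχ hν k).smul_measure ENNReal.ofReal_ne_top) ?_
  have integral_norm (k : ℕ) : ∫ x, ‖χ x‖ ∂(convPow ν k) = (∫ x, ‖χ x‖ ∂ν) ^ k :=
    integral_addChar_convPow (χ := (normHom : 𝕜 →*₀ ℝ).toMonoidHom.compAddChar χ) hχ.norm k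
  simp only [integral_smul_measure, integral_norm, smul_eq_mul]
  refine ((Real.summable_pow_div_factorial (∫ x, ‖χ x‖ ∂ν)).mul_left
    (Real.exp (-ν.real univ))).congr fun k => ?_
  rw [ENNReal.toReal_ofReal (by positivity)]
  ring

theorem integral_addChar_compoundPoisson {χ : AddChar M ℂ} (hχ : Measurable χ)
    (hν : Integrable χ ν) :
    ∫ x, χ x ∂(compoundPoisson ν) = Complex.exp (∫ x, (χ x - 1) ∂ν) := by
  have hsum : HasSum (fun k : ℕ => Complex.exp (-ν.real univ) *
      ((∫ x, χ x ∂ν) ^ k / (k.factorial : ℂ)))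
      (Complex.exp (-ν.real univ) * Complex.exp (∫ x, χ x ∂ν)) := by
    rw [Complex.exp_eq_exp_ℂ]
    exact (NormedSpace.expSeries_div_hasSum_exp (∫ x, χ x ∂ν)).mul_left _
  rw [integral_sub hν (integrable_const _), integral_const, Complex.real_smul, mul_one,
    sub_eq_neg_add, Complex.exp_add]
  refine (hasSum_integral_measure (integrable_addChar_compoundPoisson hχ hν)).unique
    (hsum.congr_fun fun k => ?_)
  rw [integral_smul_measure, integral_addChar_convPow hχ, ENNReal.toReal_ofReal (by positivity),
    Complex.real_smul]
  push_cast
  ring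

instance : IsProbabilityMeasure (compoundPoisson ν) := by
  have one_integrable : Integrable (fun _ => (1 : ℂ)) (compoundPoisson ν) :=
    integrable_addChar_compoundPoisson (χ := 1) measurable_const (integrable_const _)
  have : IsFiniteMeasure (compoundPoisson ν) :=
    (integrable_const_iff.1 one_integrable).resolve_left one_ne_zero
  have total_mass : ∫ _, (1 : ℂ) ∂(compoundPoisson ν) = Complex.exp (∫ _, (1 - 1 : ℂ) ∂ν) :=
    integral_addChar_compoundPoisson (χ := 1) measurable_const (integrable_const _)
  simp only [integral_const, Complex.real_smul, mul_one, sub_self, mul_zero, Complex.exp_zero]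
    at total_mass
  exact ⟨by rw [← ENNReal.toReal_eq_one_iff]; exact_mod_cast total_mass⟩

theorem exp_neg_mul_convPow_le_compoundPoisson (k : ℕ) (s : Set M) :
    Real.exp (-ν.real univ) / k.factorial * (convPow ν k).real s ≤ (compoundPoisson ν).real s := by
  have term_le : ENNReal.ofReal (Real.exp (-ν.real univ) / k.factorial) * convPow ν k s
      ≤ compoundPoisson ν s :=
    (ENNReal.le_tsum k).trans (Measure.le_sum_apply _ s)
  have := ENNReal.toReal_mono (measure_ne_top _ _) term_le
  rwa [ENNReal.toReal_mul, ENNReal.toReal_ofReal (by positivity)] at this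

theorem exp_neg_le_compoundPoisson_of_zero_mem {s : Set M} (hs : (0 : M) ∈ s) :
    Real.exp (-ν.real univ) ≤ (compoundPoisson ν).real s := by
  simpa [convPow, measureReal_def, hs] using exp_neg_mul_convPow_le_compoundPoisson (ν := ν) 0 s

theorem exp_neg_mul_le_compoundPoisson (s : Set M) :
    Real.exp (-ν.real univ) * ν.real s ≤ (compoundPoisson ν).real s := by
  simpa [convPow, Measure.dirac_zero_conv] using exp_neg_mul_convPow_le_compoundPoisson (ν := ν) 1 s

theorem compoundPoisson_compl_zero_le [MeasurableSingletonClass M] :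
    (compoundPoisson ν).real {0}ᶜ ≤ ν.real univ := by
  rw [measureReal_compl (measurableSet_singleton 0), probReal_univ]
  have no_jump := exp_neg_le_compoundPoisson_of_zero_mem (ν := ν) (mem_singleton (0 : M))
  have := Real.add_one_le_exp (-ν.real univ)
  linarith

end CompoundPoisson

/-! ### Compound Poisson laws on the line -/

/-- The character `x ↦ exp (z x)` of the additive group of the real line. -/
noncomputable def cexpAddChar (z : ℂ) : AddChar ℝ ℂ where
  toFun x := Complex.exp (z * x)
  map_zero_eq_one' := by simp
  map_add_eq_mul' x y := by rw [← Complex.exp_add, Complex.ofReal_add, mul_add]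

theorem measurable_cexpAddChar (z : ℂ) : Measurable (cexpAddChar z) :=
  show Measurable fun x : ℝ => Complex.exp (z * x) by fun_prop

theorem integrable_cexp_ofReal_mul_iff {μ : Measure ℝ} {l : ℝ} :
    Integrable (fun x : ℝ => Complex.exp (l * x)) μ ↔ Integrable (fun x => Real.exp (l * x)) μ := by
  simp only [← Complex.ofReal_mul, ← Complex.ofReal_exp]
  exact ⟨Integrable.re, Integrable.ofReal⟩

/-- The compound Poisson law with finite intensity `ν`, shifted to have mean zero when `ν` has a
first moment. -/
noncomputable def centeredPoisson (ν : Measure ℝ) : Measure ℝ :=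
  compoundPoisson ν ∗ Measure.dirac (-∫ x, x ∂ν)

section CenteredPoisson

variable {ν : Measure ℝ} [IsFiniteMeasure ν]

theorem complexMGF_compoundPoisson {z : ℂ}
    (hz : Integrable (fun x : ℝ => Complex.exp (z * x)) ν) :
    complexMGF id (compoundPoisson ν) z =
      Complex.exp (∫ x : ℝ, (Complex.exp (z * x) - 1) ∂ν) :=
  integral_addChar_compoundPoisson (χ := cexpAddChar z) (measurable_cexpAddChar z) hz

instance : IsProbabilityMeasure (centeredPoisson ν) := by
  unfold centeredPoisson; infer_instance

theorem complexMGF_centeredPoisson (hν : Integrable (fun x => x) ν) {z : ℂ}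
    (hz : Integrable (fun x : ℝ => Complex.exp (z * x)) ν) :
    complexMGF id (centeredPoisson ν) z =
      Complex.exp (∫ x : ℝ, (Complex.exp (z * x) - 1 - z * x) ∂ν) := by
  have shift : complexMGF id (centeredPoisson ν) z =
      complexMGF id (compoundPoisson ν) z * Complex.exp (z * (-∫ x, x ∂ν : ℝ)) := by
    refine (integral_addChar_conv (measurable_cexpAddChar z)).trans ?_
    rw [integral_dirac]
    rfl
  have split : ∫ x : ℝ, (Complex.exp (z * x) - 1 - z * x) ∂ν =
      (∫ x : ℝ, (Complex.exp (z * x) - 1) ∂ν) - z * (∫ x, x ∂ν : ℝ) := by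
    rw [← integral_complex_ofReal, ← integral_const_mul]
    exact integral_sub (hz.sub (integrable_const _)) (hν.ofReal.const_mul z)
  rw [shift, complexMGF_compoundPoisson hz, ← Complex.exp_add, split]
  push_cast
  ring_nf

theorem charFun_centeredPoisson (hν : Integrable (fun x => x) ν) (t : ℝ) :
    charFun (centeredPoisson ν) t = Complex.exp
      (∫ x, (Complex.exp (Complex.I * (t * x : ℝ)) - 1 - Complex.I * (t * x : ℝ)) ∂ν) := by
  have comm (x : ℝ) : Complex.I * (t * x : ℝ) = t * Complex.I * x := by push_cast; ring
  have hint : Integrable (fun x : ℝ => Complex.exp (t * Complex.I * x)) ν := by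
    refine (integrable_const (1 : ℝ)).mono' (by fun_prop) (.of_forall fun x => ?_)
    rw [← comm, Complex.norm_exp_I_mul_ofReal]
  simp only [comm]
  rw [← complexMGF_id_mul_I, complexMGF_centeredPoisson hν hint]

theorem integrable_exp_mul_centeredPoisson {l : ℝ}
    (hl : Integrable (fun x => Real.exp (l * x)) ν) :
    Integrable (fun x => Real.exp (l * x)) (centeredPoisson ν) := by
  have hmeas := measurable_cexpAddChar l
  exact integrable_cexp_ofReal_mul_iff.1 (integrable_addChar_conv hmeas
    (integrable_addChar_compoundPoisson hmeas (integrable_cexp_ofReal_mul_iff.2 hl))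
    (integrable_dirac enorm_lt_top))

theorem mgf_centeredPoisson (hν : Integrable (fun x => x) ν) {l : ℝ}
    (hl : Integrable (fun x => Real.exp (l * x)) ν) :
    mgf id (centeredPoisson ν) l = Real.exp (∫ x, (Real.exp (l * x) - 1 - l * x) ∂ν) := by
  have ofReal_mgf := complexMGF_centeredPoisson hν (integrable_cexp_ofReal_mul_iff.2 hl)
  rw [complexMGF_ofReal] at ofReal_mgf
  apply Complex.ofReal_injective
  rw [ofReal_mgf, Complex.ofReal_exp, ← integral_complex_ofReal]
  push_cast
  rfl

theorem conv_centeredPoisson_real_Ici (μ : Measure ℝ) [SFinite μ] (s : ℝ) :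
    (μ ∗ centeredPoisson ν).real (Ici s) =
      (μ ∗ compoundPoisson ν).real (Ici (s + ∫ x, x ∂ν)) := by
  rw [centeredPoisson, ← Measure.conv_assoc, Measure.conv_dirac,
    map_measureReal_apply (by fun_prop) measurableSet_Ici]
  congr 1
  ext x
  simp

end CenteredPoisson

/-! ### Tails of convolutions -/

section Tails

variable {μ ν : Measure ℝ} [IsProbabilityMeasure μ] [IsProbabilityMeasure ν]

theorem mul_le_conv_Ici (s t : ℝ) :
    μ.real (Ici s) * ν.real (Ici t) ≤ (μ ∗ ν).real (Ici (s + t)) := by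
  rw [← measureReal_prod_prod, Measure.conv, map_measureReal_apply (by fun_prop) measurableSet_Ici]
  exact measureReal_mono fun x hx => add_le_add (mem_Ici.1 hx.1) (mem_Ici.1 hx.2)

theorem conv_Ici_le (s : ℝ) : (μ ∗ ν).real (Ici s) ≤ μ.real (Ici s) + ν.real {0}ᶜ := by
  rw [Measure.conv, map_measureReal_apply (by fun_prop) measurableSet_Ici]
  calc (μ.prod ν).real ((fun x : ℝ × ℝ => x.1 + x.2) ⁻¹' Ici s)
      ≤ (μ.prod ν).real (Ici s ×ˢ univ ∪ univ ×ˢ {0}ᶜ) := by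
        refine measureReal_mono fun x hx => ?_
        by_cases no_jump : x.2 = 0
        · left; simpa [no_jump] using hx
        · right; simpa using no_jump
    _ ≤ (μ.prod ν).real (Ici s ×ˢ univ) + (μ.prod ν).real (univ ×ˢ {0}ᶜ) :=
        measureReal_union_le _ _
    _ = μ.real (Ici s) + ν.real {0}ᶜ := by simp [measureReal_prod_prod]

end Tails

section SecondMoment

variable {Ω : Type*} [MeasurableSpace Ω] {P : Measure Ω} {Z : Ω → ℝ}

theorem sq_setIntegral_le_mul_real [IsFiniteMeasure P] (hZ : MemLp Z 2 P) (A : Set Ω) :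
    (∫ ω in A, Z ω ∂P) ^ 2 ≤ (∫ ω, Z ω ^ 2 ∂P) * P.real A := by
  have hZA := hZ.restrict A
  have sq_le : ∫ ω in A, Z ω ^ 2 ∂P ≤ ∫ ω, Z ω ^ 2 ∂P :=
    setIntegral_le_integral hZ.integrable_sq (.of_forall fun ω => sq_nonneg _)
  have quadratic_nonneg (a : ℝ) :
      0 ≤ P.real A * (a * a) + -(2 * ∫ ω in A, Z ω ∂P) * a + ∫ ω in A, Z ω ^ 2 ∂P := by
    have expand : ∫ ω in A, (Z ω - a) ^ 2 ∂P =
        P.real A * (a * a) + -(2 * ∫ ω in A, Z ω ∂P) * a + ∫ ω in A, Z ω ^ 2 ∂P := by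
      have hlin : Integrable (fun ω => 2 * a * Z ω) (P.restrict A) :=
        (hZA.integrable one_le_two).const_mul _
      have hquad : Integrable (fun ω => Z ω ^ 2 - 2 * a * Z ω) (P.restrict A) :=
        hZA.integrable_sq.sub hlin
      have expand_sq (ω : Ω) : (Z ω - a) ^ 2 = a ^ 2 + (Z ω ^ 2 - 2 * a * Z ω) := by ring
      simp only [expand_sq]
      rw [integral_add (integrable_const _) hquad, integral_sub hZA.integrable_sq hlin,
        integral_const_mul, integral_const, measureReal_restrict_apply_univ, smul_eq_mul]
      ring
    exact expand ▸ integral_nonneg fun ω => sq_nonneg _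
  have := discrim_le_zero quadratic_nonneg
  rw [discrim] at this
  nlinarith [measureReal_nonneg (μ := P) (s := A)]

theorem paley_zygmund [IsProbabilityMeasure P] (hZ : MemLp Z 2 P) {c : ℝ} (hc : 0 ≤ c)
    (hcZ : c ≤ ∫ ω, Z ω ∂P) :
    (∫ ω, Z ω ∂P - c) ^ 2 ≤ (∫ ω, Z ω ^ 2 ∂P) * P.real {ω | c ≤ Z ω} := by
  have hA : NullMeasurableSet {ω | c ≤ Z ω} P :=
    nullMeasurableSet_le aemeasurable_const hZ.aestronglyMeasurable.aemeasurable
  have below : ∫ ω in {ω | c ≤ Z ω}ᶜ, Z ω ∂P ≤ c := by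
    calc ∫ ω in {ω | c ≤ Z ω}ᶜ, Z ω ∂P ≤ ∫ _ in {ω | c ≤ Z ω}ᶜ, c ∂P := by
          refine setIntegral_mono_on₀ (hZ.integrable one_le_two).integrableOn
            (integrable_const _) hA.compl fun ω hω => ?_
          exact le_of_not_ge hω
      _ ≤ c := by
          rw [setIntegral_const, smul_eq_mul]
          exact mul_le_of_le_one_left hc measureReal_le_one
  have split := integral_add_compl₀ hA (hZ.integrable one_le_two)
  calc (∫ ω, Z ω ∂P - c) ^ 2 ≤ (∫ ω in {ω | c ≤ Z ω}, Z ω ∂P) ^ 2 :=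
        pow_le_pow_left₀ (sub_nonneg.2 hcZ) (by linarith) 2
    _ ≤ _ := sq_setIntegral_le_mul_real hZ _

theorem sq_mgf_sub_le_mul_real [IsProbabilityMeasure P] {l s : ℝ} (hl : 0 < l)
    (hint : Integrable (fun ω => Real.exp (2 * l * Z ω)) P) (hZ : AEMeasurable Z P)
    (hs : Real.exp (l * s) ≤ mgf Z P l) :
    (mgf Z P l - Real.exp (l * s)) ^ 2 ≤ mgf Z P (2 * l) * P.real {ω | s ≤ Z ω} := by
  have exp_sq (ω : Ω) : Real.exp (l * Z ω) ^ 2 = Real.exp (2 * l * Z ω) := by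
    rw [← Real.exp_nat_mul]; push_cast; ring_nf
  have memLp : MemLp (fun ω => Real.exp (l * Z ω)) 2 P :=
    (memLp_two_iff_integrable_sq (by fun_prop)).2 (by simpa only [exp_sq])
  simpa only [mgf, exp_sq, Real.exp_le_exp, mul_le_mul_iff_right₀ hl]
    using paley_zygmund memLp (Real.exp_nonneg (l * s)) hs

end SecondMoment

/-! ### The stable Lévy measure -/

/-- The Lévy measure `x ^ (-α - 1) dx` on `(0, ∞)` of the totally asymmetric `α`-stable law. -/
noncomputable def stableLevy (α : ℝ) : Measure ℝ :=
  (volume.restrict (Ioi 0)).withDensity fun x => ENNReal.ofReal (x ^ (-α - 1))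

section StableLevy

variable {α δ R : ℝ} {s : Set ℝ} {E : Type*} [NormedAddCommGroup E] [NormedSpace ℝ E]

instance : NullSingletonClass (stableLevy α) := by
  unfold stableLevy
  infer_instance

theorem stableLevy_restrict (hs : MeasurableSet s) (hs0 : s ⊆ Ioi 0) :
    (stableLevy α).restrict s =
      (volume.restrict s).withDensity fun x => ENNReal.ofReal (x ^ (-α - 1)) := by
  rw [stableLevy, restrict_withDensity hs, Measure.restrict_restrict hs, inter_eq_left.2 hs0]

theorem toReal_ofReal_rpow_ae_eq (hs : MeasurableSet s) (hs0 : s ⊆ Ioi 0) (p : ℝ) :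
    ∀ᵐ x ∂(volume.restrict s), (ENNReal.ofReal (x ^ p)).toReal = x ^ p := by
  filter_upwards [ae_restrict_mem hs] with x hx
  exact ENNReal.toReal_ofReal (Real.rpow_nonneg (hs0 hx).le p)

theorem integrableOn_stableLevy_iff (hs : MeasurableSet s) (hs0 : s ⊆ Ioi 0) {f : ℝ → E} :
    IntegrableOn f s (stableLevy α) ↔ IntegrableOn (fun x => x ^ (-α - 1) • f x) s := by
  rw [IntegrableOn, stableLevy_restrict hs hs0,
    integrable_withDensity_iff_integrable_smul' (by fun_prop) (by simp)]
  refine integrable_congr ?_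
  filter_upwards [toReal_ofReal_rpow_ae_eq hs hs0 (-α - 1)] with x hx
  rw [hx]

theorem setIntegral_stableLevy (hs : MeasurableSet s) (hs0 : s ⊆ Ioi 0) (f : ℝ → E) :
    ∫ x in s, f x ∂(stableLevy α) = ∫ x in s, x ^ (-α - 1) • f x := by
  rw [stableLevy_restrict hs hs0,
    integral_withDensity_eq_integral_toReal_smul (by fun_prop) (by simp)]
  refine integral_congr_ae ?_
  filter_upwards [toReal_ofReal_rpow_ae_eq hs hs0 (-α - 1)] with x hx
  rw [hx]

theorem rpow_smul_pow {x : ℝ} (hx : 0 < x) (α : ℝ) (k : ℕ) :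
    x ^ (-α - 1) • x ^ k = x ^ (k - α - 1) := by
  rw [smul_eq_mul, ← Real.rpow_natCast, ← Real.rpow_add hx]
  ring_nf

theorem integrableOn_pow_stableLevy_Ioc {k : ℕ} (hk : α < k) (hR : 0 ≤ R) :
    IntegrableOn (fun x => x ^ k) (Ioc 0 R) (stableLevy α) := by
  rw [integrableOn_stableLevy_iff measurableSet_Ioc Ioc_subset_Ioi_self,
    integrableOn_congr_fun (fun x hx => rpow_smul_pow hx.1 α k) measurableSet_Ioc,
    ← intervalIntegrable_iff_integrableOn_Ioc_of_le hR]
  exact intervalIntegral.intervalIntegrable_rpow' (by linarith)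

theorem setIntegral_pow_stableLevy_Ioc {k : ℕ} (hk : α < k) (hR : 0 ≤ R) :
    ∫ x in Ioc 0 R, x ^ k ∂(stableLevy α) = R ^ (k - α) / (k - α) := by
  rw [setIntegral_stableLevy measurableSet_Ioc Ioc_subset_Ioi_self,
    setIntegral_congr_fun measurableSet_Ioc fun x hx => rpow_smul_pow hx.1 α k,
    ← intervalIntegral.integral_of_le hR, integral_rpow (Or.inl (by linarith)), sub_add_cancel,
    Real.zero_rpow (by linarith), sub_zero]

theorem integrableOn_pow_stableLevy_Ioi {k : ℕ} (hk : k < α) (hR : 0 < R) :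
    IntegrableOn (fun x => x ^ k) (Ioi R) (stableLevy α) := by
  rw [integrableOn_stableLevy_iff measurableSet_Ioi (Ioi_subset_Ioi hR.le),
    integrableOn_congr_fun (fun x (hx : x ∈ Ioi R) => rpow_smul_pow (hR.trans hx) α k)
      measurableSet_Ioi]
  exact integrableOn_Ioi_rpow_of_lt (by linarith) hR

theorem setIntegral_pow_stableLevy_Ioi {k : ℕ} (hk : k < α) (hR : 0 < R) :
    ∫ x in Ioi R, x ^ k ∂(stableLevy α) = R ^ (k - α) / (α - k) := by
  rw [setIntegral_stableLevy measurableSet_Ioi (Ioi_subset_Ioi hR.le),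
    setIntegral_congr_fun measurableSet_Ioi
      fun x (hx : x ∈ Ioi R) => rpow_smul_pow (hR.trans hx) α k,
    integral_Ioi_rpow_of_lt (by linarith) hR, sub_add_cancel, neg_div, ← div_neg, neg_sub]

theorem isFiniteMeasure_stableLevy_Ioi (hα : 0 < α) (hR : 0 < R) :
    IsFiniteMeasure ((stableLevy α).restrict (Ioi R)) := by
  have one_integrable : IntegrableOn (fun _ => (1 : ℝ)) (Ioi R) (stableLevy α) := by
    simpa only [pow_zero] using
      integrableOn_pow_stableLevy_Ioi (k := 0) (by exact_mod_cast hα) hR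
  exact (integrable_const_iff.1 one_integrable).resolve_left one_ne_zero

theorem isFiniteMeasure_stableLevy_Ioc (hα : 0 < α) (hδ : 0 < δ) (R : ℝ) :
    IsFiniteMeasure ((stableLevy α).restrict (Ioc δ R)) := by
  have := isFiniteMeasure_stableLevy_Ioi hα hδ
  exact isFiniteMeasure_of_le _ (Measure.restrict_mono_set _ Ioc_subset_Ioi_self)

theorem stableLevy_real_Ioi (hα : 0 < α) (hR : 0 < R) :
    (stableLevy α).real (Ioi R) = 1 / (α * R ^ α) := by
  have := setIntegral_pow_stableLevy_Ioi (k := 0) (by exact_mod_cast hα) hR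
  simp only [pow_zero, Nat.cast_zero, zero_sub, sub_zero, setIntegral_const, smul_eq_mul,
    mul_one] at this
  rw [this, Real.rpow_neg hR.le]
  field_simp

theorem integrableOn_id_stableLevy_Ioi (hα : 1 < α) (hR : 0 < R) :
    IntegrableOn (fun x => x) (Ioi R) (stableLevy α) := by
  simpa only [pow_one] using integrableOn_pow_stableLevy_Ioi (k := 1) (by exact_mod_cast hα) hR

theorem setIntegral_id_stableLevy_Ioi (hα : 1 < α) (hR : 0 < R) :
    ∫ x in Ioi R, x ∂(stableLevy α) = R ^ (1 - α) / (α - 1) := by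
  simpa only [pow_one, Nat.cast_one] using
    setIntegral_pow_stableLevy_Ioi (k := 1) (by exact_mod_cast hα) hR

theorem integrableOn_exp_mul_stableLevy_Ioc (hα : 0 < α) (hδ : 0 < δ) (R l : ℝ) :
    IntegrableOn (fun x => Real.exp (l * x)) (Ioc δ R) (stableLevy α) := by
  have := isFiniteMeasure_stableLevy_Ioc hα hδ R
  refine (integrable_const (Real.exp (|l| * R))).mono' (by fun_prop) ?_
  filter_upwards [ae_restrict_mem measurableSet_Ioc] with x hx
  rw [Real.norm_eq_abs, Real.abs_exp, Real.exp_le_exp]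
  calc l * x ≤ |l| * x := mul_le_mul_of_nonneg_right (le_abs_self l) (hδ.trans hx.1).le
    _ ≤ |l| * R := mul_le_mul_of_nonneg_left hx.2 (abs_nonneg l)

end StableLevy

/-! ### Weak approximation of the stable law -/

theorem norm_cexp_I_mul_sub_one_sub_le (u : ℝ) :
    ‖Complex.exp (Complex.I * u) - 1 - Complex.I * u‖ ≤ 2 * |u| :=
  calc ‖Complex.exp (Complex.I * u) - 1 - Complex.I * u‖
      ≤ ‖Complex.exp (Complex.I * u) - 1‖ + ‖Complex.I * u‖ := norm_sub_le _ _
    _ ≤ |u| + |u| := add_le_add Real.norm_exp_I_mul_ofReal_sub_one_le (by simp)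
    _ = 2 * |u| := by ring

theorem norm_cexp_I_mul_sub_one_sub_le_sq (u : ℝ) :
    ‖Complex.exp (Complex.I * u) - 1 - Complex.I * u‖ ≤ 2 * u ^ 2 := by
  have norm_eq : ‖Complex.I * (u : ℂ)‖ = |u| := by simp
  rcases le_total |u| 1 with hu | hu
  · have := Complex.norm_exp_sub_one_sub_id_le (x := Complex.I * u) (norm_eq ▸ hu)
    rw [norm_eq, sq_abs] at this
    linarith [sq_nonneg u]
  · have := norm_cexp_I_mul_sub_one_sub_le u
    rw [← sq_abs]
    nlinarith

section Approximation

variable {α δ R : ℝ}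

theorem integrableOn_stableLevy_compensated (hα1 : 1 < α) (hα2 : α < 2) (t : ℝ) :
    IntegrableOn (fun x : ℝ =>
      Complex.exp (Complex.I * (t * x : ℝ)) - 1 - Complex.I * (t * x : ℝ))
      (Ioi 0) (stableLevy α) := by
  rw [← Ioc_union_Ioi_eq_Ioi (zero_le_one' ℝ)]
  refine IntegrableOn.union ?_ ?_
  · refine ((integrableOn_pow_stableLevy_Ioc (k := 2) (by exact_mod_cast hα2)
      zero_le_one).const_mul (2 * t ^ 2)).mono' (by fun_prop) (.of_forall fun x => ?_)
    exact (norm_cexp_I_mul_sub_one_sub_le_sq (t * x)).trans_eq (by ring)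
  · refine ((integrableOn_id_stableLevy_Ioi hα1 zero_lt_one).norm.const_mul (2 * |t|)).mono'
      (by fun_prop) (.of_forall fun x => ?_)
    exact (norm_cexp_I_mul_sub_one_sub_le (t * x)).trans_eq
      (by rw [abs_mul, Real.norm_eq_abs, mul_assoc])

theorem stableExponent_eq_setIntegral (α t : ℝ) :
    stableExponent α t = ∫ x in Ioi (0 : ℝ),
      (Complex.exp (Complex.I * (t * x : ℝ)) - 1 - Complex.I * (t * x : ℝ)) ∂(stableLevy α) := by
  rw [stableExponent, setIntegral_stableLevy measurableSet_Ioi subset_rfl]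
  refine setIntegral_congr_fun measurableSet_Ioi fun x hx => ?_
  rw [show -α - 1 = -(α + 1) by ring, Real.rpow_neg hx.le, Complex.real_smul, Complex.ofReal_inv,
    div_eq_inv_mul]

/-- The law of the centred sum of the jumps in `(δ, R]`, the jumps having intensity
`stableLevy α`. -/
noncomputable def smallJumps (α δ R : ℝ) : Measure ℝ :=
  centeredPoisson ((stableLevy α).restrict (Ioc δ R))

/-- The law of the sum, not centred, of the jumps in `(R, ∞)`, the jumps having intensity
`stableLevy α`. -/
noncomputable def largeJumps (α R : ℝ) : Measure ℝ :=
  compoundPoisson ((stableLevy α).restrict (Ioi R))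

/-- The law of the centred sum of the jumps in `(δ, ∞)`. It approximates the stable law as `δ → 0`;
the level `R` only serves to separate small jumps from large ones. -/
noncomputable def truncatedStable (α δ R : ℝ) : Measure ℝ :=
  smallJumps α δ R ∗ centeredPoisson ((stableLevy α).restrict (Ioi R))

theorem isProbabilityMeasure_smallJumps (hα : 0 < α) (hδ : 0 < δ) (R : ℝ) :
    IsProbabilityMeasure (smallJumps α δ R) := by
  have := isFiniteMeasure_stableLevy_Ioc hα hδ R
  unfold smallJumps
  infer_instance

theorem isProbabilityMeasure_largeJumps (hα : 0 < α) (hR : 0 < R) :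
    IsProbabilityMeasure (largeJumps α R) := by
  have := isFiniteMeasure_stableLevy_Ioi hα hR
  unfold largeJumps
  infer_instance

theorem isProbabilityMeasure_truncatedStable (hα : 0 < α) (hδ : 0 < δ) (hR : 0 < R) :
    IsProbabilityMeasure (truncatedStable α δ R) := by
  have := isProbabilityMeasure_smallJumps hα hδ R
  have := isFiniteMeasure_stableLevy_Ioi hα hR
  unfold truncatedStable
  infer_instance

theorem truncatedStable_real_Ici (hα : 1 < α) (hδ : 0 < δ) (hR : 0 < R) (s : ℝ) :
    (truncatedStable α δ R).real (Ici s) =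
      (smallJumps α δ R ∗ largeJumps α R).real (Ici (s + R ^ (1 - α) / (α - 1))) := by
  have := isProbabilityMeasure_smallJumps (zero_lt_one.trans hα) hδ R
  have := isFiniteMeasure_stableLevy_Ioi (zero_lt_one.trans hα) hR
  rw [truncatedStable, conv_centeredPoisson_real_Ici, setIntegral_id_stableLevy_Ioi hα hR,
    largeJumps]

theorem charFun_truncatedStable (hα1 : 1 < α) (hα2 : α < 2) (hδ : 0 < δ) (hδR : δ ≤ R)
    (t : ℝ) : charFun (truncatedStable α δ R) t = Complex.exp (∫ x in Ioi δ,
      (Complex.exp (Complex.I * (t * x : ℝ)) - 1 - Complex.I * (t * x : ℝ))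
        ∂(stableLevy α)) := by
  have hα := zero_lt_one.trans hα1
  have hR := hδ.trans_le hδR
  have := isFiniteMeasure_stableLevy_Ioc hα hδ R
  have := isFiniteMeasure_stableLevy_Ioi hα hR
  have small_jumps : IntegrableOn (fun x => x) (Ioc δ R) (stableLevy α) :=
    (integrableOn_id_stableLevy_Ioi hα1 hδ).mono_set Ioc_subset_Ioi_self
  have hint := (integrableOn_stableLevy_compensated hα1 hα2 t).mono_set (Ioi_subset_Ioi hδ.le)
  rw [← Ioc_union_Ioi_eq_Ioi hδR, integrableOn_union] at hint
  rw [truncatedStable, smallJumps, charFun_conv, charFun_centeredPoisson small_jumps,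
    charFun_centeredPoisson (integrableOn_id_stableLevy_Ioi hα1 hR), ← Complex.exp_add,
    ← setIntegral_union (Ioc_disjoint_Ioi le_rfl) measurableSet_Ioi hint.1 hint.2,
    Ioc_union_Ioi_eq_Ioi hδR]

theorem tendsto_div_natCast_add_one_zero (R : ℝ) :
    Tendsto (fun n : ℕ => R / (n + 1)) atTop (𝓝 0) := by
  simpa only [div_eq_mul_one_div R, mul_zero] using
    tendsto_one_div_add_atTop_nhds_zero_nat.const_mul R

variable {Ω : Type*} [MeasurableSpace Ω] {P : Measure Ω} {X : Ω → ℝ}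

namespace IsTotallyAsymmetricStable

theorem tendsto_charFun (hα1 : 1 < α) (hα2 : α < 2)
    (hX : IsTotallyAsymmetricStable P α X) (hR : 0 < R) (t : ℝ) :
    Tendsto (fun n : ℕ => charFun (truncatedStable α (R / (n + 1)) R) t) atTop
      (𝓝 (charFun (P.map X) t)) := by
  rw [hX.charFun_eq, stableExponent_eq_setIntegral]
  have hcover := aecover_Ioi_of_Ioi (μ := stableLevy α) (tendsto_div_natCast_add_one_zero R)
  have hlim := hcover.integral_tendsto_of_countably_generated
    (integrableOn_stableLevy_compensated hα1 hα2 t)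
  refine ((Complex.continuous_exp.tendsto _).comp hlim).congr fun n => ?_
  have hδ : 0 < R / (n + 1) := by positivity
  rw [charFun_truncatedStable hα1 hα2 hδ (div_le_self hR.le (by simp)), Function.comp_apply,
    Measure.restrict_restrict measurableSet_Ioi, inter_eq_left.2 (Ioi_subset_Ioi hδ.le)]

theorem exists_tendsto_truncatedStable [IsProbabilityMeasure P] (hα1 : 1 < α) (hα2 : α < 2)
    (hX : IsTotallyAsymmetricStable P α X) (hR : 0 < R) :
    ∃ (μ : ℕ → ProbabilityMeasure ℝ) (ν : ProbabilityMeasure ℝ),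
      (∀ n, (μ n : Measure ℝ) = truncatedStable α (R / (n + 1)) R) ∧
        (ν : Measure ℝ) = P.map X ∧ Tendsto μ atTop (𝓝 ν) :=
  have hprob (n : ℕ) : IsProbabilityMeasure (truncatedStable α (R / (n + 1)) R) :=
    isProbabilityMeasure_truncatedStable (zero_lt_one.trans hα1) (by positivity) hR
  have hmap : IsProbabilityMeasure (P.map X) := Measure.isProbabilityMeasure_map hX.aemeasurable
  ⟨fun n => ⟨_, hprob n⟩, ⟨_, hmap⟩, fun _ => rfl, rfl,
    ProbabilityMeasure.tendsto_iff_tendsto_charFun.2 (hX.tendsto_charFun hα1 hα2 hR)⟩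

theorem real_setOf_ge (hX : IsTotallyAsymmetricStable P α X) (b : ℝ) :
    P.real {ω | X ω ≥ b} = (P.map X).real (Ici b) :=
  (map_measureReal_apply_of_aemeasurable hX.aemeasurable measurableSet_Ici).symm

theorem le_tail_of_truncatedStable [IsProbabilityMeasure P] (hα1 : 1 < α) (hα2 : α < 2)
    (hX : IsTotallyAsymmetricStable P α X) (hR : 0 < R) {b q : ℝ} {p : ℕ → ℝ}
    (hp : Tendsto p atTop (𝓝 q))
    (hle : ∀ n : ℕ, p n ≤ (truncatedStable α (R / (n + 1)) R).real (Ici b)) :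
    q ≤ P.real {ω | X ω ≥ b} := by
  obtain ⟨μ, ν, hμ, hν, weak_limit⟩ := hX.exists_tendsto_truncatedStable hα1 hα2 hR
  simp only [← hμ] at hle
  rw [hX.real_setOf_ge, ← hν, measureReal_def, ← ENNReal.ofReal_le_iff_le_toReal
    (measure_ne_top _ _), ← (ENNReal.tendsto_ofReal hp).limsup_eq]
  refine le_trans (limsup_le_limsup (.of_forall fun n => ?_))
    (ProbabilityMeasure.limsup_measure_closed_le_of_tendsto weak_limit isClosed_Ici)
  exact (ENNReal.ofReal_le_iff_le_toReal (measure_ne_top _ _)).2 (hle n)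

theorem tail_le_of_truncatedStable [IsProbabilityMeasure P] (hα1 : 1 < α) (hα2 : α < 2)
    (hX : IsTotallyAsymmetricStable P α X) (hR : 0 < R) {f : ℝ → ℝ} (hf : Continuous f) (b : ℝ)
    (hle : ∀ (n : ℕ) (c : ℝ), (truncatedStable α (R / (n + 1)) R).real (Ici c) ≤ f c) :
    P.real {ω | X ω ≥ b} ≤ f b := by
  obtain ⟨μ, ν, hμ, hν, weak_limit⟩ := hX.exists_tendsto_truncatedStable hα1 hα2 hR
  simp only [← hμ] at hle
  -- The portmanteau theorem bounds open sets from above, so `b` is approached from below.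
  have bound_below : ∀ c < b, (P.map X).real (Ici b) ≤ f c := by
    intro c hc
    have hf0 : 0 ≤ f c := measureReal_nonneg.trans (hle 0 c)
    rw [← hν]
    refine ENNReal.toReal_le_of_le_ofReal hf0 ((measure_mono (Ici_subset_Ioi.2 hc)).trans ?_)
    refine (ProbabilityMeasure.le_liminf_measure_open_of_tendsto weak_limit isOpen_Ioi).trans ?_
    refine liminf_le_of_frequently_le' (Eventually.frequently (.of_forall fun n => ?_))
    refine (measure_mono Ioi_subset_Ici_self).trans ?_
    exact (ENNReal.le_ofReal_iff_toReal_le (measure_ne_top _ _) hf0).2 (hle n c)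
  rw [hX.real_setOf_ge]
  exact ge_of_tendsto (hf.continuousWithinAt (s := Iio b))
    (eventually_nhdsWithin_of_forall bound_below)

end IsTotallyAsymmetricStable

end Approximation

/-! ### Exponential moments of the small jumps -/

theorem hasSum_exp_sub_quadratic (u : ℝ) :
    HasSum (fun k : ℕ => u ^ (k + 3) / ((k + 3).factorial : ℝ))
      (Real.exp u - 1 - u - u ^ 2 / 2) := by
  have exp_series := NormedSpace.expSeries_div_hasSum_exp u
  rw [← Real.exp_eq_exp_ℝ, ← hasSum_nat_add_iff' 3] at exp_series
  have head : Real.exp u - ∑ i ∈ Finset.range 3, u ^ i / (i.factorial : ℝ) =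
      Real.exp u - 1 - u - u ^ 2 / 2 := by
    simp only [Finset.sum_range_succ, Finset.sum_range_zero, Nat.factorial]
    push_cast
    ring
  rwa [head] at exp_series

theorem exp_sub_quadratic_mul_le {s u : ℝ} (hs0 : 0 ≤ s) (hs1 : s ≤ 1) (hu : 0 ≤ u) :
    Real.exp (s * u) - 1 - s * u - (s * u) ^ 2 / 2 ≤
      s ^ 3 * (Real.exp u - 1 - u - u ^ 2 / 2) := by
  refine hasSum_le (fun k => ?_) (hasSum_exp_sub_quadratic (s * u))
    ((hasSum_exp_sub_quadratic u).mul_left (s ^ 3))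
  rw [mul_pow, mul_div_assoc]
  exact mul_le_mul_of_nonneg_right (pow_le_pow_of_le_one hs0 hs1 (by lia)) (by positivity)

theorem exp_neg_le_quadratic {v : ℝ} (hv : 0 ≤ v) : Real.exp (-v) ≤ 1 - v + v ^ 2 / 2 := by
  have quadratic_pos : 0 < 1 - v + v ^ 2 / 2 := by nlinarith [sq_nonneg (v - 1)]
  rw [Real.exp_neg, inv_le_comm₀ (Real.exp_pos v) quadratic_pos,
    inv_le_iff_one_le_mul₀ quadratic_pos]
  calc 1 ≤ (1 + v + v ^ 2 / 2) * (1 - v + v ^ 2 / 2) := by nlinarith [sq_nonneg (v ^ 2)]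
    _ ≤ Real.exp v * (1 - v + v ^ 2 / 2) :=
        mul_le_mul_of_nonneg_right (Real.quadratic_le_exp_of_nonneg hv) quadratic_pos.le

/-- The exponent `∫₀^R (e^{lx} - 1 - lx) x^{-α-1} dx` of the Laplace transform of the centred sum
of the jumps of size at most `R`. -/
noncomputable def laplaceExponent (α R l : ℝ) : ℝ :=
  ∫ x in Ioc 0 R, (Real.exp (l * x) - 1 - l * x) ∂(stableLevy α)

section LaplaceExponent

variable {α δ R l : ℝ}

theorem exp_sub_one_sub_nonneg (u : ℝ) : 0 ≤ Real.exp u - 1 - u := by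
  linarith [Real.add_one_le_exp u]

theorem exp_sub_one_sub_le_sq_mul_exp_abs (u : ℝ) :
    Real.exp u - 1 - u ≤ u ^ 2 * Real.exp |u| := by
  have exp_sub_one_le : Real.exp u - 1 ≤ u * Real.exp u := by
    have inverse : Real.exp (-u) * Real.exp u = 1 := by rw [← Real.exp_add, neg_add_cancel,
      Real.exp_zero]
    nlinarith [Real.add_one_le_exp (-u), Real.exp_pos u]
  rcases le_total 0 u with hu | hu
  · rw [abs_of_nonneg hu]
    nlinarith
  · nlinarith [Real.add_one_le_exp u, Real.one_le_exp (abs_nonneg u), sq_nonneg u]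

theorem integrableOn_exp_sub_one_sub (hα : α < 2) (hR : 0 ≤ R) (l : ℝ) :
    IntegrableOn (fun x => Real.exp (l * x) - 1 - l * x) (Ioc 0 R) (stableLevy α) := by
  refine ((integrableOn_pow_stableLevy_Ioc (k := 2) (by exact_mod_cast hα) hR).const_mul
    (l ^ 2 * Real.exp (|l| * R))).mono' (by fun_prop) ?_
  filter_upwards [ae_restrict_mem measurableSet_Ioc] with x hx
  have exp_le : Real.exp |l * x| ≤ Real.exp (|l| * R) := by
    rw [abs_mul, abs_of_pos hx.1]
    gcongr
    exact hx.2
  rw [Real.norm_of_nonneg (exp_sub_one_sub_nonneg _)]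
  calc Real.exp (l * x) - 1 - l * x ≤ (l * x) ^ 2 * Real.exp |l * x| :=
        exp_sub_one_sub_le_sq_mul_exp_abs _
    _ ≤ (l * x) ^ 2 * Real.exp (|l| * R) := by gcongr
    _ = l ^ 2 * Real.exp (|l| * R) * x ^ 2 := by ring

theorem setIntegral_mul_sq_div_two (hα : α < 2) (hR : 0 ≤ R) (l : ℝ) :
    ∫ x in Ioc 0 R, (l * x) ^ 2 / 2 ∂(stableLevy α) = l ^ 2 / 2 * (R ^ (2 - α) / (2 - α)) := by
  have expand (x : ℝ) : (l * x) ^ 2 / 2 = l ^ 2 / 2 * x ^ 2 := by ring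
  simp only [expand]
  rw [integral_const_mul, setIntegral_pow_stableLevy_Ioc (by exact_mod_cast hα) hR, Nat.cast_ofNat]

theorem integrableOn_mul_sq_div_two (hα : α < 2) (hR : 0 ≤ R) (l : ℝ) :
    IntegrableOn (fun x => (l * x) ^ 2 / 2) (Ioc 0 R) (stableLevy α) := by
  have expand (x : ℝ) : (l * x) ^ 2 / 2 = l ^ 2 / 2 * x ^ 2 := by ring
  simp only [expand]
  exact (integrableOn_pow_stableLevy_Ioc (by exact_mod_cast hα) hR).const_mul _

theorem le_laplaceExponent (hα : α < 2) (hR : 0 ≤ R) (hl : 0 ≤ l) :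
    l ^ 2 / 2 * (R ^ (2 - α) / (2 - α)) ≤ laplaceExponent α R l := by
  rw [← setIntegral_mul_sq_div_two hα hR]
  refine setIntegral_mono_on (integrableOn_mul_sq_div_two hα hR l)
    (integrableOn_exp_sub_one_sub hα hR l) measurableSet_Ioc fun x hx => ?_
  linarith [Real.quadratic_le_exp_of_nonneg (mul_nonneg hl hx.1.le)]

theorem laplaceExponent_neg_le (hα : α < 2) (hR : 0 ≤ R) (hl : 0 ≤ l) :
    laplaceExponent α R (-l) ≤ l ^ 2 / 2 * (R ^ (2 - α) / (2 - α)) := by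
  rw [← setIntegral_mul_sq_div_two hα hR]
  refine setIntegral_mono_on (integrableOn_exp_sub_one_sub hα hR (-l))
    (integrableOn_mul_sq_div_two hα hR l) measurableSet_Ioc fun x hx => ?_
  rw [neg_mul]
  linarith [exp_neg_le_quadratic (mul_nonneg hl hx.1.le)]

theorem laplaceExponent_le (hα : α < 2) (hR : 0 < R) (hl : 0 ≤ l) :
    laplaceExponent α R l ≤ l ^ 2 / 2 * (R ^ (2 - α) / (2 - α)) +
      (Real.exp (l * R) - 1 - l * R - (l * R) ^ 2 / 2) / ((3 - α) * R ^ α) := by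
  set ρ := Real.exp (l * R) - 1 - l * R - (l * R) ^ 2 / 2
  have hα3 : α < (3 : ℕ) := by push_cast; linarith
  have cubic_integral : ∫ x in Ioc 0 R, ρ / R ^ 3 * x ^ 3 ∂(stableLevy α) =
      ρ / ((3 - α) * R ^ α) := by
    rw [integral_const_mul, setIntegral_pow_stableLevy_Ioc hα3 hR.le, Real.rpow_sub hR,
      Real.rpow_natCast]
    have : R ^ α ≠ 0 := (Real.rpow_pos_of_pos hR α).ne'
    have : 3 - α ≠ 0 := by linarith
    push_cast
    field_simp
  have cubic_integrable := (integrableOn_pow_stableLevy_Ioc hα3 hR.le).const_mul (ρ / R ^ 3)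
  rw [← setIntegral_mul_sq_div_two hα hR.le, ← cubic_integral,
    ← integral_add (integrableOn_mul_sq_div_two hα hR.le l) cubic_integrable]
  refine setIntegral_mono_on (integrableOn_exp_sub_one_sub hα hR.le l)
    ((integrableOn_mul_sq_div_two hα hR.le l).add cubic_integrable) measurableSet_Ioc fun x hx => ?_
  have remainder_le := exp_sub_quadratic_mul_le (s := x / R) (u := l * R)
    (div_nonneg hx.1.le hR.le) ((div_le_one hR).2 hx.2) (mul_nonneg hl hR.le)
  have rescale : x / R * (l * R) = l * x := by field_simp
  have cubic : (x / R) ^ 3 * ρ = ρ / R ^ 3 * x ^ 3 := by ring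
  rw [rescale, cubic] at remainder_le
  linarith

theorem mgf_smallJumps (hα : 1 < α) (hδ : 0 < δ) (R l : ℝ) :
    mgf id (smallJumps α δ R) l =
      Real.exp (∫ x in Ioc δ R, (Real.exp (l * x) - 1 - l * x) ∂(stableLevy α)) := by
  have := isFiniteMeasure_stableLevy_Ioc (zero_lt_one.trans hα) hδ R
  have first_moment : IntegrableOn (fun x => x) (Ioc δ R) (stableLevy α) :=
    (integrableOn_id_stableLevy_Ioi hα hδ).mono_set Ioc_subset_Ioi_self
  exact mgf_centeredPoisson first_moment
    (integrableOn_exp_mul_stableLevy_Ioc (zero_lt_one.trans hα) hδ R l)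

theorem integrable_exp_mul_smallJumps (hα : 0 < α) (hδ : 0 < δ) (R l : ℝ) :
    Integrable (fun x => Real.exp (l * x)) (smallJumps α δ R) := by
  have := isFiniteMeasure_stableLevy_Ioc hα hδ R
  exact integrable_exp_mul_centeredPoisson (integrableOn_exp_mul_stableLevy_Ioc hα hδ R l)

theorem mgf_smallJumps_le (hα1 : 1 < α) (hα2 : α < 2) (hδ : 0 < δ) (hR : 0 ≤ R) (l : ℝ) :
    mgf id (smallJumps α δ R) l ≤ Real.exp (laplaceExponent α R l) := by
  rw [mgf_smallJumps hα1 hδ, Real.exp_le_exp]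
  exact setIntegral_mono_set (integrableOn_exp_sub_one_sub hα2 hR l)
    (.of_forall fun x => exp_sub_one_sub_nonneg (l * x))
    (Ioc_subset_Ioc_left hδ.le).eventuallyLE

theorem tendsto_mgf_smallJumps (hα1 : 1 < α) (hα2 : α < 2) (hR : 0 < R) (l : ℝ) :
    Tendsto (fun n : ℕ => mgf id (smallJumps α (R / (n + 1)) R) l) atTop
      (𝓝 (Real.exp (laplaceExponent α R l))) := by
  have hcover := aecover_Ioc_of_Ioc (μ := stableLevy α) (tendsto_div_natCast_add_one_zero R)
    (tendsto_const_nhds (x := R))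
  have hlim := hcover.integral_tendsto_of_countably_generated
    (integrableOn_exp_sub_one_sub hα2 hR.le l)
  refine ((Real.continuous_exp.tendsto _).comp hlim).congr fun n => ?_
  have hδ : 0 < R / (n + 1) := by positivity
  rw [mgf_smallJumps hα1 hδ, Function.comp_apply, Measure.restrict_restrict measurableSet_Ioc,
    inter_eq_left.2 (Ioc_subset_Ioc_left hδ.le)]

end LaplaceExponent

/-! ### Tail bounds in terms of small and large jumps -/

section TailBounds

variable {α R l : ℝ} {Ω : Type*} [MeasurableSpace Ω] {P : Measure Ω} [IsProbabilityMeasure P]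
  {X : Ω → ℝ}

namespace IsTotallyAsymmetricStable

theorem tail_le_exp_laplaceExponent (hα1 : 1 < α) (hα2 : α < 2)
    (hX : IsTotallyAsymmetricStable P α X) (hR : 0 < R) (hl : 0 ≤ l) (b : ℝ) :
    P.real {ω | X ω ≥ b} ≤ 1 / (α * R ^ α) +
      Real.exp (laplaceExponent α R l - l * (b + R ^ (1 - α) / (α - 1))) := by
  refine hX.tail_le_of_truncatedStable hα1 hα2 hR (f := fun b => 1 / (α * R ^ α) +
    Real.exp (laplaceExponent α R l - l * (b + R ^ (1 - α) / (α - 1)))) (by fun_prop) b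
    fun n c => ?_
  have hα := zero_lt_one.trans hα1
  have hδ : 0 < R / (n + 1) := by positivity
  have := isProbabilityMeasure_smallJumps hα hδ R
  have := isFiniteMeasure_stableLevy_Ioi hα hR
  have := isProbabilityMeasure_largeJumps hα hR
  set c' := c + R ^ (1 - α) / (α - 1)
  have some_large_jump : (largeJumps α R).real {0}ᶜ ≤ 1 / (α * R ^ α) := by
    have := compoundPoisson_compl_zero_le (ν := (stableLevy α).restrict (Ioi R))
    rwa [measureReal_restrict_apply_univ, stableLevy_real_Ioi hα hR] at this
  have chernoff : (smallJumps α (R / (n + 1)) R).real (Ici c') ≤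
      Real.exp (laplaceExponent α R l - l * c') :=
    calc (smallJumps α (R / (n + 1)) R).real (Ici c')
        ≤ Real.exp (-l * c') * mgf id (smallJumps α (R / (n + 1)) R) l :=
          measure_ge_le_exp_mul_mgf c' hl (integrable_exp_mul_smallJumps hα hδ R l)
      _ ≤ Real.exp (-l * c') * Real.exp (laplaceExponent α R l) :=
          mul_le_mul_of_nonneg_left (mgf_smallJumps_le hα1 hα2 hδ hR.le l) (Real.exp_nonneg _)
      _ = Real.exp (laplaceExponent α R l - l * c') := by rw [← Real.exp_add]; ring_nf
  rw [truncatedStable_real_Ici hα1 hδ hR, add_comm (1 / _)]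
  exact (conv_Ici_le c').trans (add_le_add chernoff some_large_jump)

theorem mul_le_tail (hα1 : 1 < α) (hα2 : α < 2) (hX : IsTotallyAsymmetricStable P α X)
    (hR : 0 < R) {s t k q : ℝ} {p : ℕ → ℝ} (hp : Tendsto p atTop (𝓝 q))
    (hs : ∀ n : ℕ, p n ≤ (smallJumps α (R / (n + 1)) R).real (Ici s))
    (hk : 0 ≤ k) (ht : k ≤ (largeJumps α R).real (Ici t)) :
    q * k ≤ P.real {ω | X ω ≥ s + t - R ^ (1 - α) / (α - 1)} := by
  refine hX.le_tail_of_truncatedStable hα1 hα2 hR (hp.mul_const k) fun n => ?_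
  have hδ : 0 < R / (n + 1) := by positivity
  have := isProbabilityMeasure_smallJumps (zero_lt_one.trans hα1) hδ R
  have := isProbabilityMeasure_largeJumps (zero_lt_one.trans hα1) hR
  rw [truncatedStable_real_Ici hα1 hδ hR, sub_add_cancel]
  exact (mul_le_mul (hs n) ht hk measureReal_nonneg).trans (mul_le_conv_Ici s t)

end IsTotallyAsymmetricStable

end TailBounds

/-! ### Lower bounds for the tail -/

section LowerBounds

variable {α : ℝ} {Ω : Type*} [MeasurableSpace Ω] {P : Measure Ω} [IsProbabilityMeasure P]
  {X : Ω → ℝ}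

theorem one_sub_exp_le_smallJumps_Ici_neg (hα1 : 1 < α) (hα2 : α < 2) {δ s : ℝ} (hδ : 0 < δ)
    (hs : 0 ≤ s) :
    1 - Real.exp (-((2 - α) * s ^ 2 / 2)) ≤ (smallJumps α δ 1).real (Ici (-s)) := by
  have hα0 : 0 < α := zero_lt_one.trans hα1
  have hε : 0 < 2 - α := sub_pos.2 hα2
  have := isProbabilityMeasure_smallJumps hα0 hδ 1
  set l := (2 - α) * s
  have hl : 0 ≤ l := by positivity
  have exponent_le : laplaceExponent α 1 (-l) ≤ l * s / 2 := by
    refine (laplaceExponent_neg_le hα2 zero_le_one hl).trans_eq ?_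
    rw [Real.one_rpow]
    simp only [l]
    field_simp
  have lower_tail : (smallJumps α δ 1).real (Iio (-s)) ≤ Real.exp (-((2 - α) * s ^ 2 / 2)) :=
    calc (smallJumps α δ 1).real (Iio (-s))
        ≤ (smallJumps α δ 1).real (Iic (-s)) := measureReal_mono Iio_subset_Iic_self
      _ ≤ Real.exp (- -l * -s) * mgf id (smallJumps α δ 1) (-l) :=
          measure_le_le_exp_mul_mgf (-s) (neg_nonpos.2 hl)
            (integrable_exp_mul_smallJumps hα0 hδ 1 (-l))
      _ ≤ Real.exp (- -l * -s) * Real.exp (l * s / 2) := by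
          gcongr
          exact (mgf_smallJumps_le hα1 hα2 hδ zero_le_one (-l)).trans
            (Real.exp_le_exp.2 exponent_le)
      _ = Real.exp (-((2 - α) * s ^ 2 / 2)) := by
          rw [← Real.exp_add]
          congr 1
          simp only [l]
          ring
  have complement := probReal_compl_eq_one_sub (μ := smallJumps α δ 1)
    (measurableSet_Iio (a := -s))
  rw [compl_Iio] at complement
  linarith

theorem exp_neg_le_largeJumps_Ici_zero (hα : 0 < α) {R : ℝ} (hR : 0 < R) :
    Real.exp (-(1 / (α * R ^ α))) ≤ (largeJumps α R).real (Ici 0) := by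
  have := isFiniteMeasure_stableLevy_Ioi hα hR
  rw [← stableLevy_real_Ioi hα hR, ← measureReal_restrict_apply_univ (Ioi R)]
  exact exp_neg_le_compoundPoisson_of_zero_mem self_mem_Ici

theorem exp_neg_mul_le_largeJumps_Ici (hα : 0 < α) {R t : ℝ} (hR : 0 < R) (ht : R < t) :
    Real.exp (-(1 / (α * R ^ α))) * (1 / (α * t ^ α)) ≤ (largeJumps α R).real (Ici t) := by
  have := isFiniteMeasure_stableLevy_Ioi hα hR
  have single_jump : ((stableLevy α).restrict (Ioi R)).real (Ici t) = 1 / (α * t ^ α) := by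
    rw [measureReal_restrict_apply measurableSet_Ici,
      inter_eq_left.2 (Ici_subset_Ioi.2 ht), measureReal_congr Ioi_ae_eq_Ici.symm,
      stableLevy_real_Ioi hα (hR.trans ht)]
  rw [← single_jump, ← stableLevy_real_Ioi hα hR, ← measureReal_restrict_apply_univ (Ioi R)]
  exact exp_neg_mul_le_compoundPoisson _

theorem one_div_mul_one_rpow_le_one (hα : 1 ≤ α) : 1 / (α * 1 ^ α) ≤ 1 := by
  rw [Real.one_rpow, mul_one]
  exact (div_le_one (by linarith)).2 hα

theorem one_div_eighteen_mul_one_div_rpow_le {y : ℝ} (hα1 : 0 < α) (hα2 : α ≤ 2) (hy : 0 < y) :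
    1 / 18 * (1 / y ^ α) ≤ 1 / (α * (3 * y) ^ α) := by
  have three_rpow : (3 : ℝ) ^ α ≤ 9 :=
    (Real.rpow_le_rpow_of_exponent_le (by norm_num) hα2).trans_eq (by norm_num)
  rw [Real.mul_rpow (by norm_num) hy.le, one_div_mul_one_div]
  refine one_div_le_one_div_of_le (by positivity) ?_
  calc α * (3 ^ α * y ^ α) ≤ 2 * (9 * y ^ α) := by gcongr
    _ = 18 * y ^ α := by ring

namespace IsTotallyAsymmetricStable

theorem one_div_rpow_le_tail (hα1 : 1 < α) (hα2 : α < 2) (hX : IsTotallyAsymmetricStable P α X)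
    {y : ℝ} (hy : 1 ≤ y) (hw : 1 ≤ (2 - α) * y ^ 2) :
    1 / 200 * (1 / y ^ α) ≤ P.real {ω | X ω ≥ y - 1 / (α - 1)} := by
  have hα0 : 0 < α := zero_lt_one.trans hα1
  have hy0 : 0 < y := zero_lt_one.trans_le hy
  have jump_and_small := hX.mul_le_tail hα1 hα2 zero_lt_one tendsto_const_nhds
    (fun n => one_sub_exp_le_smallJumps_Ici_neg hα1 hα2 (by positivity) (s := 2 * y)
      (by positivity)) (by positivity)
    (exp_neg_mul_le_largeJumps_Ici hα0 zero_lt_one (t := 3 * y) (by linarith))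
  have location : -(2 * y) + 3 * y - 1 ^ (1 - α) / (α - 1) = y - 1 / (α - 1) := by
    rw [Real.one_rpow]; ring
  rw [location] at jump_and_small
  refine le_trans ?_ jump_and_small
  have exp_le_half : Real.exp (-((2 - α) * (2 * y) ^ 2 / 2)) ≤ 1 / 2 :=
    (Real.exp_le_exp.2 (by linarith)).trans (Real.exp_neg_one_lt_half.le)
  have third_le : 1 / 3 ≤ Real.exp (-(1 / (α * 1 ^ α))) := by
    linarith [Real.exp_neg_one_gt_d9,
      Real.exp_le_exp.2 (neg_le_neg (one_div_mul_one_rpow_le_one hα1.le))]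
  calc 1 / 200 * (1 / y ^ α) ≤ (1 - 1 / 2) * (1 / 3 * (1 / 18 * (1 / y ^ α))) := by
        have : 0 < 1 / y ^ α := by positivity
        linarith
    _ ≤ (1 - Real.exp (-((2 - α) * (2 * y) ^ 2 / 2))) *
          (Real.exp (-(1 / (α * 1 ^ α))) * (1 / (α * (3 * y) ^ α))) := by
        have far_jump := one_div_eighteen_mul_one_div_rpow_le hα0 hα2.le hy0
        gcongr
        linarith

theorem sq_exp_laplaceExponent_sub_le_tail (hα1 : 1 < α) (hα2 : α < 2)
    (hX : IsTotallyAsymmetricStable P α X) {R l s : ℝ} (hR : 0 < R) (hl : 0 < l)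
    (hs : l * s ≤ laplaceExponent α R l) :
    (Real.exp (laplaceExponent α R l) - Real.exp (l * s)) ^ 2 /
        Real.exp (laplaceExponent α R (2 * l)) * Real.exp (-(1 / (α * R ^ α))) ≤
      P.real {ω | X ω ≥ s - R ^ (1 - α) / (α - 1)} := by
  have hα0 : 0 < α := zero_lt_one.trans hα1
  set Λ := laplaceExponent α R
  let m (n : ℕ) := mgf id (smallJumps α (R / (n + 1)) R) l
  let p (n : ℕ) := (max (m n - Real.exp (l * s)) 0) ^ 2 / Real.exp (Λ (2 * l))
  have tendsto_p : Tendsto p atTop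
      (𝓝 ((Real.exp (Λ l) - Real.exp (l * s)) ^ 2 / Real.exp (Λ (2 * l)))) := by
    have := ((tendsto_mgf_smallJumps hα1 hα2 hR l).sub_const (Real.exp (l * s))).max
      (tendsto_const_nhds (x := (0 : ℝ)))
    rw [max_eq_left (sub_nonneg.2 (Real.exp_le_exp.2 hs))] at this
    exact (this.pow 2).div_const _
  have p_le (n : ℕ) : p n ≤ (smallJumps α (R / (n + 1)) R).real (Ici s) := by
    have hδ : 0 < R / (n + 1) := by positivity
    have := isProbabilityMeasure_smallJumps hα0 hδ R
    rcases le_total (m n) (Real.exp (l * s)) with h | h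
    · simp only [p, max_eq_right (sub_nonpos.2 h), ne_eq, OfNat.ofNat_ne_zero, not_false_eq_true,
        zero_pow, zero_div, measureReal_nonneg]
    · simp only [p, max_eq_left (sub_nonneg.2 h)]
      rw [div_le_iff₀' (Real.exp_pos _)]
      refine (sq_mgf_sub_le_mul_real hl (integrable_exp_mul_smallJumps hα0 hδ R (2 * l))
        aemeasurable_id h).trans ?_
      exact mul_le_mul_of_nonneg_right (mgf_smallJumps_le hα1 hα2 hδ hR.le _) measureReal_nonneg
  simpa only [add_zero] using hX.mul_le_tail hα1 hα2 hR tendsto_p p_le (Real.exp_nonneg _)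
    (exp_neg_le_largeJumps_Ici_zero hα0 hR)

end IsTotallyAsymmetricStable

theorem laplaceExponent_one_two_mul_le (hα : α < 2) {l : ℝ} (hl0 : 0 ≤ l) (hl1 : l ≤ 1) :
    laplaceExponent α 1 (2 * l) ≤ 2 * l ^ 2 / (2 - α) + 3 / (3 - α) := by
  have remainder_le : Real.exp (l * 2) - 1 - l * 2 - (l * 2) ^ 2 / 2 ≤ 3 := by
    have exp_two_le : Real.exp 2 - 1 - 2 - 2 ^ 2 / 2 ≤ 3 := by
      have : Real.exp 2 = Real.exp 1 ^ 2 := by rw [← Real.exp_nat_mul]; norm_num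
      nlinarith [Real.exp_one_gt_d9, Real.exp_one_lt_d9]
    calc Real.exp (l * 2) - 1 - l * 2 - (l * 2) ^ 2 / 2
        ≤ l ^ 3 * (Real.exp 2 - 1 - 2 - 2 ^ 2 / 2) :=
          exp_sub_quadratic_mul_le hl0 hl1 zero_le_two
      _ ≤ l ^ 3 * 3 := by gcongr
      _ ≤ 3 := mul_le_of_le_one_left (by norm_num) (pow_le_one₀ hl0 hl1)
  have bound := laplaceExponent_le hα zero_lt_one (mul_nonneg zero_le_two hl0)
  rw [Real.one_rpow, Real.one_rpow, mul_one, mul_one, mul_comm 2 l] at bound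
  rw [mul_comm 2 l]
  refine bound.trans (add_le_add (le_of_eq ?_) ?_)
  · ring
  · exact div_le_div_of_nonneg_right remainder_le (by linarith)

theorem exp_neg_div_le_sq_exp_sub {w : ℝ} (hw : 4 ≤ w) :
    1 / 200 * Real.exp (-w) ≤
      (Real.exp (w / 2) - Real.exp (w / 4)) ^ 2 / Real.exp (2 * w + 3) * Real.exp (-1) := by
  have factor : (Real.exp (w / 2) - Real.exp (w / 4)) ^ 2 / Real.exp (2 * w + 3) * Real.exp (-1) =
      (1 - Real.exp (-(w / 4))) ^ 2 * Real.exp (-1) ^ 4 * Real.exp (-w) := by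
    have : Real.exp (w / 2) - Real.exp (w / 4) =
        Real.exp (w / 2) * (1 - Real.exp (-(w / 4))) := by
      rw [mul_one_sub, ← Real.exp_add]
      ring_nf
    have exponents : Real.exp (w / 2) ^ 2 / Real.exp (2 * w + 3) * Real.exp (-1) =
        Real.exp (-1) ^ 4 * Real.exp (-w) := by
      rw [← Real.exp_nat_mul, ← Real.exp_nat_mul, ← Real.exp_sub, ← Real.exp_add, ← Real.exp_add]
      push_cast
      ring_nf
    rw [this, mul_pow, mul_assoc, ← exponents]
    ring
  have exp_neg_le : Real.exp (-(w / 4)) ≤ 0.37 :=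
    (Real.exp_le_exp.2 (by linarith : -(w / 4) ≤ -1)).trans
      (by linarith [Real.exp_neg_one_lt_d9])
  rw [factor]
  refine mul_le_mul_of_nonneg_right ?_ (Real.exp_nonneg _)
  calc (1 / 200 : ℝ) ≤ (1 - 0.37) ^ 2 * 0.36 ^ 4 := by norm_num
    _ ≤ (1 - Real.exp (-(w / 4))) ^ 2 * Real.exp (-1) ^ 4 := by
        gcongr
        linarith [Real.exp_neg_one_gt_d9]

theorem IsTotallyAsymmetricStable.exp_neg_le_tail (hα1 : 1 < α) (hα2 : α < 2)
    (hX : IsTotallyAsymmetricStable P α X) {y : ℝ} (hy0 : 0 < y) (hy : (2 - α) * y ≤ 1)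
    (hw : 4 ≤ (2 - α) * y ^ 2) :
    1 / 200 * Real.exp (-(2 - α) * y ^ 2) ≤ P.real {ω | X ω ≥ 1 / 4 * y - 1 / (α - 1)} := by
  have hε : 0 < 2 - α := sub_pos.2 hα2
  set w := (2 - α) * y ^ 2
  set l := (2 - α) * y
  have hl : 0 < l := by positivity
  have sq_div : l ^ 2 / (2 - α) = w := by simp only [l, w]; field_simp
  have le_exponent : w / 2 ≤ laplaceExponent α 1 l := by
    refine le_of_eq_of_le ?_ (le_laplaceExponent hα2 zero_le_one hl.le)
    rw [Real.one_rpow, ← sq_div]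
    ring
  have exponent_le : laplaceExponent α 1 (2 * l) ≤ 2 * w + 3 := by
    refine (laplaceExponent_one_two_mul_le hα2 hl.le hy).trans (add_le_add (le_of_eq ?_) ?_)
    · rw [← sq_div]; ring
    · exact div_le_self (by norm_num) (by linarith)
  have level : l * (1 / 4 * y) = w / 4 := by simp only [l, w]; ring
  have tilted := hX.sq_exp_laplaceExponent_sub_le_tail hα1 hα2 zero_lt_one hl
    (s := 1 / 4 * y) (by linarith)
  rw [level, Real.one_rpow (1 - α)] at tilted
  rw [neg_mul]
  calc 1 / 200 * Real.exp (-w)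
      ≤ (Real.exp (w / 2) - Real.exp (w / 4)) ^ 2 / Real.exp (2 * w + 3) * Real.exp (-1) :=
        exp_neg_div_le_sq_exp_sub hw
    _ ≤ _ := by
        have := one_div_mul_one_rpow_le_one hα1.le
        gcongr
        exact sub_nonneg.2 (Real.exp_le_exp.2 (by linarith))
    _ ≤ P.real {ω | X ω ≥ 1 / 4 * y - 1 / (α - 1)} := tilted

theorem IsTotallyAsymmetricStable.one_div_rpow_add_exp_neg_le_tail (hα1 : 1 < α) (hα2 : α < 2)
    (hX : IsTotallyAsymmetricStable P α X) {y : ℝ} (hy1 : 1 ≤ y) (hy : (2 - α) * y ≤ 1)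
    (hw : 4 ≤ (2 - α) * y ^ 2) :
    1 / (400 * √(Real.exp 1)) * (Real.exp (-1) * (1 / y ^ α) + Real.exp (-(2 - α) * y ^ 2)) ≤
      P.real {ω | X ω ≥ 1 / 4 * y - 1 / (α - 1)} := by
  have rpow_le : 1 / 200 * (1 / y ^ α) ≤ P.real {ω | X ω ≥ 1 / 4 * y - 1 / (α - 1)} :=
    (hX.one_div_rpow_le_tail hα1 hα2 hy1 (by linarith)).trans
      (measureReal_mono fun ω (hω : y - 1 / (α - 1) ≤ X ω) =>
        (by linarith : 1 / 4 * y - 1 / (α - 1) ≤ X ω))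
  have gaussian_le := hX.exp_neg_le_tail hα1 hα2 (by linarith) hy hw
  have constant_le : 1 / (400 * √(Real.exp 1)) ≤ 1 / 400 :=
    one_div_le_one_div_of_le (by norm_num)
      (le_mul_of_one_le_right (by norm_num) (Real.one_le_sqrt.2 (Real.one_le_exp zero_le_one)))
  calc 1 / (400 * √(Real.exp 1)) * (Real.exp (-1) * (1 / y ^ α) + Real.exp (-(2 - α) * y ^ 2))
      ≤ 1 / 400 * (1 * (1 / y ^ α) + Real.exp (-(2 - α) * y ^ 2)) := by
        gcongr
        exact Real.exp_le_one_iff.2 (by norm_num)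
    _ ≤ P.real {ω | X ω ≥ 1 / 4 * y - 1 / (α - 1)} := by linarith

end LowerBounds

/-! ### Upper bounds for the tail -/

section UpperBounds

variable {α : ℝ} {Ω : Type*} [MeasurableSpace Ω] {P : Measure Ω} [IsProbabilityMeasure P]
  {X : Ω → ℝ}

theorem laplaceExponent_div_le (hα : α < 2) {y u : ℝ} (hy : 0 < y) (hu : 0 ≤ u) :
    laplaceExponent α y (u / y) ≤
      1 / y ^ α * (u ^ 2 / (2 * (2 - α))) + 1 / y ^ α * Real.exp u := by
  have hε : 2 - α ≠ 0 := (sub_pos.2 hα).ne'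
  have hyα : 0 < y ^ α := Real.rpow_pos_of_pos hy α
  refine (laplaceExponent_le hα hy (div_nonneg hu hy.le)).trans (add_le_add (le_of_eq ?_) ?_)
  · rw [Real.rpow_sub hy, Real.rpow_ofNat]
    field_simp
  · rw [div_mul_cancel₀ _ hy.ne', one_div_mul_eq_div]
    exact div_le_div₀ (Real.exp_nonneg u) (by nlinarith) hyα
      (le_mul_of_one_le_left hyα.le (by linarith))

theorem IsTotallyAsymmetricStable.tail_two_mul_le (hα1 : 1 < α) (hα2 : α < 2)
    (hX : IsTotallyAsymmetricStable P α X) {y u s : ℝ} (hy : 0 < y) (hu : 0 ≤ u)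
    (hs : (1 - y ^ (1 - α)) / (α - 1) ≤ s) :
    P.real {ω | X ω ≥ 2 * y - 1 / (α - 1)} ≤ 1 / (α * y ^ α) +
      Real.exp (1 / y ^ α * (u ^ 2 / (2 * (2 - α))) + 1 / y ^ α * Real.exp u - 2 * u +
        u * (s / y)) := by
  refine (hX.tail_le_exp_laplaceExponent hα1 hα2 hy (div_nonneg hu hy.le) _).trans ?_
  gcongr
  have shift : u / y * (2 * y - 1 / (α - 1) + y ^ (1 - α) / (α - 1)) =
      2 * u - u / y * ((1 - y ^ (1 - α)) / (α - 1)) := by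
    field_simp
    ring
  have shift_le : u / y * ((1 - y ^ (1 - α)) / (α - 1)) ≤ u * (s / y) :=
    (mul_le_mul_of_nonneg_left hs (div_nonneg hu hy.le)).trans_eq (by ring)
  rw [shift]
  linarith [laplaceExponent_div_le hα2 hy hu]

theorem log_div_self_le_exp_neg_one {x : ℝ} (hx : 0 < x) : Real.log x / x ≤ Real.exp (-1) := by
  have := Real.exp_one_mul_le_exp (x := Real.log x)
  rwa [Real.exp_log hx, ← le_div_iff₀' (Real.exp_pos 1), div_eq_mul_inv, ← Real.exp_neg,
    ← div_le_iff₀' hx] at this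

theorem one_sub_rpow_div_le_log (hα : 1 < α) {y : ℝ} (hy : 0 < y) :
    (1 - y ^ (1 - α)) / (α - 1) ≤ Real.log y := by
  rw [div_le_iff₀ (by linarith), Real.rpow_def_of_pos hy]
  linarith [Real.add_one_le_exp (Real.log y * (1 - α))]

theorem one_div_rpow_mul_log_le (hα1 : 1 < α) (hα2 : α < 2) {y : ℝ} (hy : 1 / (2 - α) ≤ y) :
    1 / y ^ α * (α * Real.log y / (2 * (2 - α))) ≤ 3 / 2 * Real.exp (-1) := by
  have hε : 0 < 2 - α := sub_pos.2 hα2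
  have hy1 : 1 ≤ y := ((one_le_div hε).2 (by linarith)).trans hy
  have hy0 : 0 < y := zero_lt_one.trans_le hy1
  have hlog : 0 ≤ Real.log y := Real.log_nonneg hy1
  rcases le_total α (3 / 2) with h | h
  · have log_div_le := log_div_self_le_exp_neg_one (Real.rpow_pos_of_pos hy0 α)
    rw [Real.log_rpow hy0] at log_div_le
    calc 1 / y ^ α * (α * Real.log y / (2 * (2 - α)))
        = α * Real.log y / y ^ α / (2 * (2 - α)) := by ring
      _ ≤ α * Real.log y / y ^ α := div_le_self (by positivity) (by linarith)
      _ ≤ 3 / 2 * Real.exp (-1) := by linarith [Real.exp_pos (-1)]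
  · have log_div_le := log_div_self_le_exp_neg_one (Real.rpow_pos_of_pos hy0 (α - 1))
    rw [Real.log_rpow hy0] at log_div_le
    have hα0 : α - 1 ≠ 0 := by linarith
    have ratio_le : α / (α - 1) ≤ 3 := (div_le_iff₀ (by linarith)).2 (by linarith)
    have : 0 ≤ α / (α - 1) := div_nonneg (by linarith) (by linarith)
    calc 1 / y ^ α * (α * Real.log y / (2 * (2 - α)))
        = 1 / y ^ α * (α * Real.log y / 2 * (1 / (2 - α))) := by field_simp
      _ ≤ 1 / y ^ α * (α * Real.log y / 2 * y) := by gcongr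
      _ = α / (α - 1) * ((α - 1) * Real.log y / y ^ (α - 1)) / 2 := by
          rw [Real.rpow_sub_one hy0.ne']
          field_simp
      _ ≤ 3 * Real.exp (-1) / 2 := by gcongr
      _ = 3 / 2 * Real.exp (-1) := by ring

theorem IsTotallyAsymmetricStable.tail_two_mul_le_rpow (hα1 : 1 < α) (hα2 : α < 2)
    (hX : IsTotallyAsymmetricStable P α X) {y : ℝ} (hy : 1 / (2 - α) ≤ y) :
    P.real {ω | X ω ≥ 2 * y - 1 / (α - 1)} ≤ 8 / y ^ α := by
  have hy1 : 1 ≤ y := ((one_le_div (sub_pos.2 hα2)).2 (by linarith)).trans hy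
  have hy0 : 0 < y := zero_lt_one.trans_le hy1
  have hyα : 0 < y ^ α := Real.rpow_pos_of_pos hy0 α
  set u := α * Real.log y with hu
  have hu0 : 0 ≤ u := mul_nonneg (by linarith) (Real.log_nonneg hy1)
  have exp_u : Real.exp u = y ^ α := by rw [Real.rpow_def_of_pos hy0, hu, mul_comm]
  have exponent_le : 1 / y ^ α * (u ^ 2 / (2 * (2 - α))) + 1 / y ^ α * Real.exp u - 2 * u +
      u * (Real.log y / y) ≤ 1 - u := by
    have quadratic : 1 / y ^ α * (u ^ 2 / (2 * (2 - α))) =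
        u * (1 / y ^ α * (u / (2 * (2 - α)))) := by ring
    rw [quadratic, exp_u, one_div_mul_cancel hyα.ne']
    nlinarith [one_div_rpow_mul_log_le hα1 hα2 hy, log_div_self_le_exp_neg_one hy0,
      Real.exp_neg_one_lt_d9]
  calc P.real {ω | X ω ≥ 2 * y - 1 / (α - 1)}
      ≤ 1 / (α * y ^ α) + Real.exp (1 - u) :=
        (hX.tail_two_mul_le hα1 hα2 hy0 hu0 (one_sub_rpow_div_le_log hα1 hy0)).trans
          (by gcongr)
    _ ≤ 1 / y ^ α + Real.exp 1 / y ^ α := by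
        rw [Real.exp_sub, exp_u]
        gcongr
        exact le_mul_of_one_le_left hyα.le hα1.le
    _ = (1 + Real.exp 1) / y ^ α := by ring
    _ ≤ 8 / y ^ α := by
        gcongr
        linarith [Real.exp_one_lt_d9]

end UpperBounds

/-! ### The exponent in the Gaussian regime -/

/-- The exponent obtained by Chernoff's bound at `2y - 1/(α - 1)` with parameter `u / y`, the jumps
being truncated at `y` and the parameter satisfying `exp u ≤ y ^ α`. The quadratic term is written
with denominator `2w`, where `w = (2 - α)y²`. -/
noncomputable def chernoffExponent (α y u : ℝ) : ℝ :=
  y ^ (2 - α) * u ^ 2 / (2 * ((2 - α) * y ^ 2)) + 1 - 2 * u + u * (1 / (α - 1) / y)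

section GaussianRegime

variable {α y : ℝ}

theorem IsTotallyAsymmetricStable.tail_two_mul_le_exp_chernoffExponent {Ω : Type*}
    [MeasurableSpace Ω] {P : Measure Ω} [IsProbabilityMeasure P] {X : Ω → ℝ} (hα1 : 1 < α)
    (hα2 : α < 2) (hX : IsTotallyAsymmetricStable P α X) {u : ℝ} (hy : 0 < y) (hu : 0 ≤ u)
    (hu_log : u ≤ α * Real.log y) :
    P.real {ω | X ω ≥ 2 * y - 1 / (α - 1)} ≤
      1 / (α * y ^ α) + Real.exp (chernoffExponent α y u) := by
  have shift_le : (1 - y ^ (1 - α)) / (α - 1) ≤ 1 / (α - 1) := by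
    have : 0 < α - 1 := sub_pos.2 hα1
    gcongr
    exact sub_le_self 1 (Real.rpow_nonneg hy.le _)
  refine (hX.tail_two_mul_le hα1 hα2 hy hu shift_le).trans ?_
  have exp_le : 1 / y ^ α * Real.exp u ≤ 1 := by
    rw [one_div_mul_eq_div, div_le_one (Real.rpow_pos_of_pos hy α), Real.rpow_def_of_pos hy,
      mul_comm (Real.log y)]
    exact Real.exp_le_exp.2 hu_log
  have quadratic : 1 / y ^ α * (u ^ 2 / (2 * (2 - α))) =
      y ^ (2 - α) * u ^ 2 / (2 * ((2 - α) * y ^ 2)) := by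
    have : 2 - α ≠ 0 := (sub_pos.2 hα2).ne'
    have : y ^ α ≠ 0 := (Real.rpow_pos_of_pos hy α).ne'
    rw [Real.rpow_sub hy, Real.rpow_ofNat]
    field_simp
  gcongr
  rw [quadratic, chernoffExponent]
  linarith

theorem two_sub_one_div_le {a : ℝ} (ha : 0 < a) (hay : a ≤ y) (hy : (2 - α) * y ≤ 1) :
    2 - 1 / a ≤ α := by
  have exponent_le : 2 - α ≤ 1 / y := (le_div_iff₀ (ha.trans_le hay)).2 hy
  linarith [one_div_le_one_div_of_le ha hay]

theorem rpow_two_sub_le {n : ℕ} {c : ℝ} (hn : 3 ≤ n) (hny : n ≤ y) (hc : 0 < c)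
    (hnc : n ≤ c ^ n) (hy : (2 - α) * y ≤ 1) : y ^ (2 - α) ≤ c := by
  have hn3 : (3 : ℝ) ≤ n := by exact_mod_cast hn
  have hn0 : (0 : ℝ) < n := by linarith
  have hy0 : 0 < y := by linarith
  have he : Real.exp 1 ≤ n := Real.exp_one_lt_three.le.trans hn3
  have log_y : Real.log y / y ≤ Real.log n / n :=
    Real.log_div_self_antitoneOn he (he.trans hny) hny
  have log_n : Real.log n / n ≤ Real.log c := by
    rw [div_le_iff₀' hn0, ← Real.log_pow]
    exact Real.log_le_log hn0 hnc
  have exponent_le : 2 - α ≤ 1 / y := (le_div_iff₀ hy0).2 hy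
  rw [Real.rpow_def_of_pos hy0, ← Real.le_log_iff_exp_le hc]
  calc Real.log y * (2 - α) ≤ Real.log y * (1 / y) :=
        mul_le_mul_of_nonneg_left exponent_le (Real.log_nonneg (by linarith))
    _ = Real.log y / y := mul_one_div _ _
    _ ≤ Real.log c := log_y.trans log_n

theorem one_div_sub_one_div_le {a : ℝ} (ha : 1 < a) (hay : a ≤ y)
    (hy : (2 - α) * y ≤ 1) : 1 / (α - 1) / y ≤ 1 / (a - 1) := by
  rw [div_div]
  exact one_div_le_one_div_of_le (sub_pos.2 ha) (by linarith)

theorem chernoffExponent_le {n : ℕ} {c u : ℝ} (hα2 : α < 2) (hn : 3 ≤ n)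
    (hny : n ≤ y) (hc : 0 < c) (hnc : n ≤ c ^ n) (hy : (2 - α) * y ≤ 1) (hu : 0 ≤ u) :
    chernoffExponent α y u ≤
      c * u ^ 2 / (2 * ((2 - α) * y ^ 2)) + 1 - 2 * u + u * (1 / (n - 1)) := by
  have hn1 : (1 : ℝ) < n := by exact_mod_cast (by lia : 1 < n)
  have : 0 < 2 - α := sub_pos.2 hα2
  have rpow_le := rpow_two_sub_le hn hny hc hnc hy
  have shift_le := one_div_sub_one_div_le hn1 hny hy
  unfold chernoffExponent
  gcongr

theorem sq_div_add_half_le_of_ratio {c r u w : ℝ} (hu : 0 < u) (huw : u ≤ w) (hwu : w ≤ r * u)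
    (hcr : c ≤ r) (hr : 0 < r) :
    c * u ^ 2 / (2 * w) + w / 2 ≤ (c / (2 * r) + r / 2) * u := by
  have hw : 0 < w := hu.trans_le huw
  have gap : (c / (2 * r) + r / 2) * u - (c * u ^ 2 / (2 * w) + w / 2) =
      (r * u - w) * (r * w - c * u) / (2 * r * w) := by
    field_simp
    ring
  have : 0 ≤ (r * u - w) * (r * w - c * u) / (2 * r * w) :=
    div_nonneg (mul_nonneg (sub_nonneg.2 hwu) (sub_nonneg.2 (by gcongr))) (by positivity)
  linarith

theorem chernoffExponent_le_of_ratio {n : ℕ} {c r u : ℝ} (hα2 : α < 2) (hn : 3 ≤ n)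
    (hny : n ≤ y) (hc : 0 < c) (hnc : n ≤ c ^ n) (hy : (2 - α) * y ≤ 1) (hu : 0 < u)
    (huw : u ≤ (2 - α) * y ^ 2) (hwu : (2 - α) * y ^ 2 ≤ r * u) (hcr : c ≤ r) :
    chernoffExponent α y u ≤
      1 - (2 - 1 / (n - 1) - c / (2 * r) - r / 2) * u - (2 - α) * y ^ 2 / 2 := by
  linarith [chernoffExponent_le hα2 hn hny hc hnc hy hu.le,
    sq_div_add_half_le_of_ratio hu huw hwu hcr (hc.trans_le hcr)]

theorem lt_of_mul_log_lt {a b c : ℝ} (ha : 0 < a) (hc : 0 ≤ c) (hay : a ≤ y)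
    (hca : a ≤ c * Real.log a) (hcb : b ≤ c * Real.log b) (hcy : c * Real.log y < y) : b < y := by
  by_contra! hyb
  -- By concavity, `x ≤ c log x` on `[a, b]` as soon as it holds at both endpoints.
  have concave : ConcaveOn ℝ (Ioi 0) fun x => c * Real.log x - x :=
    (strictConcaveOn_log_Ioi.concaveOn.smul hc).sub (convexOn_id (convex_Ioi 0))
  have := concave.min_le_of_mem_Icc ha (show b ∈ Ioi 0 from ha.trans_le (hay.trans hyb)) ⟨hay, hyb⟩
  linarith [le_min (sub_nonneg.2 hca) (sub_nonneg.2 hcb)]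

theorem le_mul_log {a L : ℝ} (ha : 1 ≤ a) (hay : a ≤ y) (hL : 0 ≤ L) (hLa : L ≤ Real.log a)
    (hy : (2 - α) * y ≤ 1) : (2 - 1 / a) * L ≤ α * Real.log y := by
  have hα_ge : 2 - 1 / a ≤ α := two_sub_one_div_le (by linarith) hay hy
  have : 1 / a ≤ 1 := (div_le_one (by linarith)).2 ha
  exact mul_le_mul hα_ge (hLa.trans (Real.log_le_log (by linarith) hay)) hL (by linarith)

theorem le_log_four : 18 / 13 ≤ Real.log 4 := by
  linarith [Real.log_four_eq, Real.log_two_gt_d9]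

theorem le_log_six : 34 / 19 ≤ Real.log 6 := by
  have : Real.log 6 = Real.log 2 + Real.log 3 := by norm_num [← Real.log_mul]
  linarith [Real.log_two_gt_d9, Real.log_three_gt_d9]

theorem le_log_ten : 23 / 10 ≤ Real.log 10 := by
  linarith [Real.log_ten_eq, Real.log_two_gt_d9, Real.log_five_gt_d9]

theorem chernoffExponent_min_le (hα : α < 2) (hy4 : 4 ≤ y) (hy : (2 - α) * y ≤ 1)
    (hw4 : 4 ≤ (2 - α) * y ^ 2) (hw : (2 - α) * y ^ 2 ≤ 2 * (α * Real.log y)) :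
    chernoffExponent α y (min ((2 - α) * y ^ 2) (α * Real.log y)) ≤
      1 / 4 - (2 - α) * y ^ 2 / 2 := by
  set u := min ((2 - α) * y ^ 2) (α * Real.log y) with hu
  have u_ge : 63 / 26 ≤ u := by
    have := le_mul_log (by norm_num) hy4 (by norm_num) le_log_four hy
    exact le_min (by linarith) (by linarith)
  have w_le : (2 - α) * y ^ 2 ≤ 2 * u := by
    rw [hu, mul_min_of_nonneg _ _ zero_le_two]
    exact le_min (by linarith) hw
  have := chernoffExponent_le_of_ratio (n := 4) (c := 1.415) hα (by norm_num)
    (by exact_mod_cast hy4) (by norm_num) (by norm_num) hy (by linarith) (min_le_left _ _)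
    w_le (by norm_num)
  norm_num at this
  linarith

theorem chernoffExponent_mul_log_le (hα : α < 2) (hy6 : 6 ≤ y) (hy : (2 - α) * y ≤ 1)
    (hw : α * Real.log y ≤ (2 - α) * y ^ 2) (hw' : (2 - α) * y ^ 2 ≤ 2.6 * (α * Real.log y)) :
    chernoffExponent α y (α * Real.log y) ≤ 1 / 4 - (2 - α) * y ^ 2 / 2 := by
  have u_ge := le_mul_log (by norm_num) hy6 (by norm_num) le_log_six hy
  have := chernoffExponent_le_of_ratio (n := 6) (c := 1.35) hα (by norm_num)
    (by exact_mod_cast hy6) (by norm_num) (by norm_num) hy (by linarith) hw hw' (by norm_num)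
  norm_num at this
  linarith

theorem chernoffExponent_mul_log_le_neg (hα : α < 2) (hy10 : 10 ≤ y) (hy : (2 - α) * y ≤ 1)
    (hw : 2.6 * (α * Real.log y) ≤ (2 - α) * y ^ 2) :
    chernoffExponent α y (α * Real.log y) ≤ -(7 / 4) - α * Real.log y := by
  have u_ge := le_mul_log (by norm_num) hy10 (by norm_num) le_log_ten hy
  set u := α * Real.log y
  have bound := chernoffExponent_le (n := 10) (c := 1.26) (u := u) hα (by norm_num)
    (by exact_mod_cast hy10) (by norm_num) (by norm_num) hy (by linarith)
  have quadratic_le : 1.26 * u ^ 2 / (2 * ((2 - α) * y ^ 2)) ≤ 0.243 * u := by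
    rw [div_le_iff₀ (by linarith)]
    nlinarith
  norm_num at bound quadratic_le
  linarith

theorem six_lt_of_mul_log_lt (hy4 : 4 ≤ y) (hy : (2 - α) * y ≤ 1)
    (hlog : 2 * (α * Real.log y) < y) : 6 < y := by
  have log_pos : 0 < Real.log y := Real.log_pos (by linarith)
  refine lt_of_mul_log_lt (c := 7 / 2) (by norm_num) (by norm_num) hy4
    (by linarith [le_log_four]) (by linarith [le_log_six]) ?_
  nlinarith [two_sub_one_div_le (by norm_num) hy4 hy]

theorem ten_lt_of_mul_log_lt (hy6 : 6 ≤ y) (hy : (2 - α) * y ≤ 1)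
    (hlog : 2.6 * (α * Real.log y) < y) : 10 < y := by
  have log_pos : 0 < Real.log y := Real.log_pos (by linarith)
  refine lt_of_mul_log_lt (c := 4.75) (by norm_num) (by norm_num) hy6
    (by linarith [le_log_six]) (by linarith [le_log_ten]) ?_
  nlinarith [two_sub_one_div_le (by norm_num) hy6 hy]

theorem exp_neg_seven_quarters_le (hα : 19 / 10 ≤ α) :
    Real.exp (-(7 / 4)) ≤ 2 / Real.exp 1 - 1 / α := by
  have exp_le : Real.exp (-(7 / 4)) ≤ 1 / 5 := by
    have : Real.exp (-(7 / 4)) ^ 4 = Real.exp (-1) ^ 7 := by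
      rw [← Real.exp_nat_mul, ← Real.exp_nat_mul]
      norm_num
    refine le_of_pow_le_pow_left₀ (n := 4) (by norm_num) (by norm_num) ?_
    calc Real.exp (-(7 / 4)) ^ 4 = Real.exp (-1) ^ 7 := this
      _ ≤ 0.36788 ^ 7 := by
          gcongr
          linarith [Real.exp_neg_one_lt_d9]
      _ ≤ (1 / 5) ^ 4 := by norm_num
  have inv_le : 1 / α ≤ 10 / 19 := by
    rw [div_le_div_iff₀ (by linarith) (by norm_num)]
    linarith
  have two_div_exp : 2 / Real.exp 1 = 2 * Real.exp (-1) := by rw [Real.exp_neg, div_eq_mul_inv]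
  linarith [Real.exp_neg_one_gt_d9]

theorem exp_chernoffExponent_mul_log_le (hα : α < 2) (hy10 : 10 ≤ y) (hy : (2 - α) * y ≤ 1)
    (hw : 2.6 * (α * Real.log y) ≤ (2 - α) * y ^ 2) :
    Real.exp (chernoffExponent α y (α * Real.log y)) ≤
      (2 / Real.exp 1 - 1 / α) * (1 / y ^ α) := by
  have hα_ge := two_sub_one_div_le (by norm_num) hy10 hy
  calc Real.exp (chernoffExponent α y (α * Real.log y))
      ≤ Real.exp (-(7 / 4) - α * Real.log y) :=
        Real.exp_le_exp.2 (chernoffExponent_mul_log_le_neg hα hy10 hy hw)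
    _ = Real.exp (-(7 / 4)) * (1 / y ^ α) := by
        rw [Real.exp_sub, Real.rpow_def_of_pos (by linarith : 0 < y), mul_comm α,
          div_eq_mul_one_div]
    _ ≤ (2 / Real.exp 1 - 1 / α) * (1 / y ^ α) := by
        have : 0 < y := by linarith
        gcongr
        exact exp_neg_seven_quarters_le (by linarith)

theorem exists_exp_chernoffExponent_le (hα : α < 2) (hy4 : 4 ≤ y) (hy : (2 - α) * y ≤ 1)
    (hw4 : 4 ≤ (2 - α) * y ^ 2) :
    ∃ u, 0 ≤ u ∧ u ≤ α * Real.log y ∧ Real.exp (chernoffExponent α y u) ≤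
      (2 / Real.exp 1 - 1 / α) * (1 / y ^ α) +
        Real.exp (1 / 4) * Real.exp (-((2 - α) * y ^ 2 / 2)) := by
  have hα_ge : 2 - 1 / 4 ≤ α := two_sub_one_div_le (by norm_num) hy4 hy
  have u_pos : 0 < α * Real.log y := mul_pos (by linarith) (Real.log_pos (by linarith))
  have w_le : (2 - α) * y ^ 2 ≤ y := by nlinarith
  have coeff_nonneg : 0 ≤ 2 / Real.exp 1 - 1 / α := by
    rw [sub_nonneg, div_le_div_iff₀ (by linarith) (Real.exp_pos 1)]
    linarith [Real.exp_one_lt_d9]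
  have rpow_nonneg : 0 ≤ (2 / Real.exp 1 - 1 / α) * (1 / y ^ α) :=
    mul_nonneg coeff_nonneg (one_div_nonneg.2 (Real.rpow_nonneg (by linarith) α))
  have of_gaussian {u : ℝ} (h : chernoffExponent α y u ≤ 1 / 4 - (2 - α) * y ^ 2 / 2) :
      Real.exp (chernoffExponent α y u) ≤ (2 / Real.exp 1 - 1 / α) * (1 / y ^ α) +
        Real.exp (1 / 4) * Real.exp (-((2 - α) * y ^ 2 / 2)) := by
    rw [← Real.exp_add, ← sub_eq_add_neg]
    linarith [Real.exp_le_exp.2 h]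
  rcases le_or_gt ((2 - α) * y ^ 2) (2 * (α * Real.log y)) with near | not_near
  · exact ⟨_, le_min (by linarith) u_pos.le, min_le_right _ _,
      of_gaussian (chernoffExponent_min_le hα hy4 hy hw4 near)⟩
  have hy6 := six_lt_of_mul_log_lt hy4 hy (not_near.trans_le w_le)
  refine ⟨_, u_pos.le, le_rfl, ?_⟩
  rcases le_or_gt ((2 - α) * y ^ 2) (2.6 * (α * Real.log y)) with mid | far
  · exact of_gaussian (chernoffExponent_mul_log_le hα hy6.le hy (by linarith) mid)
  have hy10 := ten_lt_of_mul_log_lt hy6.le hy (far.trans_le w_le)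
  exact (exp_chernoffExponent_mul_log_le hα hy10.le hy far.le).trans
    (le_add_of_nonneg_right (by positivity))

theorem IsTotallyAsymmetricStable.tail_two_mul_le_rpow_add_exp_neg {Ω : Type*} [MeasurableSpace Ω]
    {P : Measure Ω} [IsProbabilityMeasure P] {X : Ω → ℝ} (hα1 : 1 < α) (hα2 : α < 2)
    (hX : IsTotallyAsymmetricStable P α X) (hy4 : 4 ≤ y) (hy : (2 - α) * y ≤ 1)
    (hw : 4 ≤ (2 - α) * y ^ 2) :
    P.real {ω | X ω ≥ 2 * y - 1 / (α - 1)} ≤ 2 / Real.exp 1 * (1 / y ^ α) +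
      Real.exp (1 / 4) * Real.exp (-(1 / 2) * (2 - α) * y ^ 2) := by
  obtain ⟨u, hu0, hu_log, hu⟩ := exists_exp_chernoffExponent_le hα2 hy4 hy hw
  have tail := hX.tail_two_mul_le_exp_chernoffExponent hα1 hα2 (by linarith) hu0 hu_log
  have some_jump : 1 / (α * y ^ α) = 1 / α * (1 / y ^ α) := (one_div_mul_one_div _ _).symm
  have gaussian : -(1 / 2) * (2 - α) * y ^ 2 = -((2 - α) * y ^ 2 / 2) := by ring
  rw [gaussian]
  linarith

end GaussianRegime

theorem theorem12 {Ω : Type*} [MeasurableSpace Ω] (P : Measure Ω) [IsProbabilityMeasure P]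
    (α : ℝ) (hα1 : 1 < α) (hα2 : α < 2) (X : Ω → ℝ)
    (hX : IsTotallyAsymmetricStable P α X) :
    (∀ y : ℝ, 2 / √(2 - α) ≤ y → y ≤ 1 / (2 - α) →
      P.real {ω | X ω ≥ 2 * y - 1 / (α - 1)}
          ≤ 2 / Real.exp 1 * (1 / y ^ α)
            + Real.exp (1 / 4) * Real.exp (-(1 / 2) * (2 - α) * y ^ 2) ∧
      P.real {ω | X ω ≥ 1 / 4 * y - 1 / (α - 1)}
          ≥ 1 / (400 * √(Real.exp 1))
            * (Real.exp (-1) * (1 / y ^ α) + Real.exp (-(2 - α) * y ^ 2))) ∧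
    (∀ y : ℝ, 1 / (2 - α) ≤ y →
      P.real {ω | X ω ≥ 2 * y - 1 / (α - 1)} ≤ 8 / y ^ α ∧
      P.real {ω | X ω ≥ y - 1 / (α - 1)} ≥ (10 : ℝ) ^ (-3 : ℤ) * (1 / y ^ α)) := by
  have hε : 0 < 2 - α := sub_pos.2 hα2
  refine ⟨fun y hy_ge hy_le => ?_, fun y hy => ⟨hX.tail_two_mul_le_rpow hα1 hα2 hy, ?_⟩⟩
  · have hy0 : 0 < y := lt_of_lt_of_le (by positivity) hy_ge
    have hw : 4 ≤ (2 - α) * y ^ 2 := by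
      have := pow_le_pow_left₀ (by positivity) hy_ge 2
      rw [div_pow, Real.sq_sqrt hε.le, div_le_iff₀' hε] at this
      linarith
    have hy : (2 - α) * y ≤ 1 := (le_div_iff₀' hε).1 hy_le
    have hy4 : 4 ≤ y := by nlinarith
    exact ⟨hX.tail_two_mul_le_rpow_add_exp_neg hα1 hα2 hy4 hy hw,
      hX.one_div_rpow_add_exp_neg_le_tail hα1 hα2 (by linarith) hy hw⟩
  · have hy1 : 1 ≤ y := ((one_le_div hε).2 (by linarith)).trans hy
    have hw : 1 ≤ (2 - α) * y ^ 2 := by nlinarith [(div_le_iff₀' hε).1 hy]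
    refine le_trans ?_ (hX.one_div_rpow_le_tail hα1 hα2 hy1 hw)
    gcongr
    norm_num
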